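/- **Theorem 1.** Consider $T\ge 2$ repeated first-price auctions. In round $t=1,\dots,T$ a bidder sees a value $v_t\in[0,\bar v]$, submits a bid $b_t\ge 0$, and wins iff $b_t\ge d_t$, where $d_t\ge 0$ is the maximum competing bid. A win gives the reward $r_t=v_t-b_t$ at the cost $c_t=b_t$; otherwise $r_t=c_t=0$. The $v_t$ are i.i.d. with law $F$ on $[0,\bar v]$, the $d_t$ are i.i.d. with law $G$ on $[0,\infty)$, and the two sequences are independent. The budget is $B=\rho T$ with $\rho\in(0,\bar v]$. Under full information feedback $d_t$ is revealed after every round, so a (possibly randomized) strategy $\pi$ chooses its decision in round $t$ (whether to take part, and the bid) from $(v_s,d_s)_{s<t}$, $v_t$ and its private randomness; a bidder who does not take part has $r_t=c_t=0$. Let $\Pi_0$ be the set of strategies with $\sum_{t=1}^T c_t\le\rho T$ for all realizations $v\in[0,\bar v]^T$, $d\in[0,\infty)^T$ and of the randomness, let $R(\pi)=\mathbb E\big[\sum_{t=1}^T r_t\big]$, and let $$\mathrm{Reg}(\pi)=\sup_{\pi'\in\Pi_0}R(\pi')-R(\pi).$$ Algorithm 1, with step size $\varepsilon>0$ and without knowledge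 of $F$ and $G$, is the following. Bid $b_1=0$; put $B_2=\rho T$, $\lambda_2=0$. For $t=2,\dots,T$: let $$\tilde r_t(v,b)=\frac1{t-1}\sum_{s=1}^{t-1}\mathbf 1\{b\ge d_s\}(v-b),\qquad \tilde c_t(b)=\frac1{t-1}\sum_{s=1}^{t-1}\mathbf 1\{b\ge d_s\}\,b,$$ bid the smallest maximizer $b_t$ of $\tilde r_t(v_t,b)-\lambda_t\tilde c_t(b)$ over $b\ge0$, put $\lambda_{t+1}=\max\{0,\lambda_t-\varepsilon(\rho-\tilde c_t(b_t))\}$ and $B_{t+1}=B_t-c_t$, and stop taking part in the auctions if $B_{t+1}<\bar v$. For all $0<\rho\le\bar v$ and $c_1,c_2>0$ there is a constant $C$, depending only on $\bar v,\rho,c_1,c_2$, such that for all $T\ge2$ and all step sizes $\varepsilon$ with $c_1T^{-1/2}\le\varepsilon\le c_2T^{-1/2}$ the following holds. Algorithm 1 is a well-defined (measurable, non-anticipating) strategy, which is in $\Pi_0$ whenever $\rho T\ge\bar v$; and for all laws $F$ on $[0,\bar v]$ and $G$ on $[0,\infty)$ the supremum above is finite and $$\mathrm{Reg}(\text{Algorithm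 1})\le C\sqrt{T\ln T}.$$ -/

import Mathlib

open MeasureTheory Set Finset

namespace FirstPrice

/-- A realization of values and maximum competing bids: `(ω t).1` is the value `v_t` and
`(ω t).2` the maximum competing bid `d_t` of round `t`. Rounds are `t = 1, …, T`; the other
coordinates are never used. -/
abbrev Path : Type := ℕ → ℝ × ℝ

/-- The realizations that the model allows: `v_t ∈ [0, vbar]` and `d_t ∈ ℝ₊`. -/
def Realizable (vbar : ℝ) (ω : Path) : Prop :=
  ∀ t, 0 ≤ (ω t).1 ∧ (ω t).1 ≤ vbar ∧ 0 ≤ (ω t).2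

/-- The law of the i.i.d. pairs `(v_t, d_t)`, with `v_t ∼ F` and `d_t ∼ G` independent. -/
noncomputable def pathLaw (F G : Measure ℝ) [IsProbabilityMeasure F] [IsProbabilityMeasure G] :
    Measure Path :=
  Measure.infinitePi (fun _ : ℕ => F.prod G)

/-- The data of a (possibly randomized) bidding strategy: a random seed with its law, the rounds
in which the bidder takes part, and the bids. A bidder who does not take part in a round neither
wins nor pays in it; taking part in every round is the special case `enter t ω u = True`.
The requirements on these data are collected in `Strategy.Valid`. -/
structure Strategy where
  Seed : Type
  [measurableSeed : MeasurableSpace Seed]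
  seedLaw : Measure Seed
  enter : ℕ → Path → Seed → Prop
  bid : ℕ → Path → Seed → ℝ

attribute [instance] Strategy.measurableSeed

/-- Under full information feedback the round-`t` decision is a measurable function of the seed,
the history `(v_s, d_s)`, `s < t`, and the current value `v_t`. The past outcomes
`x_s = 1{b_s ≥ d_s}` and the past bids are themselves functions of these data. -/
structure Strategy.Valid (π : Strategy) : Prop where
  prob : IsProbabilityMeasure π.seedLaw
  measurable_enter : ∀ t, MeasurableSet {z : Path × π.Seed | π.enter t z.1 z.2}
  measurable_bid : ∀ t, Measurable (fun z : Path × π.Seed => π.bid t z.1 z.2)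
  bid_nonneg : ∀ t ω u, 0 ≤ π.bid t ω u
  nonanticipating : ∀ t (ω ω' : Path) u,
    (∀ s, 1 ≤ s → s < t → ω s = ω' s) → (ω t).1 = (ω' t).1 →
      (π.enter t ω u ↔ π.enter t ω' u) ∧ π.bid t ω u = π.bid t ω' u

/-- The bidder wins round `t`; ties are broken in favor of the bidder. -/
def Strategy.Wins (π : Strategy) (t : ℕ) (ω : Path) (u : π.Seed) : Prop :=
  π.enter t ω u ∧ (ω t).2 ≤ π.bid t ω u

open Classical in
/-- The reward of round `t` in a first-price auction. -/
noncomputable def Strategy.reward (π : Strategy) (t : ℕ) (ω : Path) (u : π.Seed) : ℝ :=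
  if π.Wins t ω u then (ω t).1 - π.bid t ω u else 0

open Classical in
/-- The cost of round `t` in a first-price auction. -/
noncomputable def Strategy.cost (π : Strategy) (t : ℕ) (ω : Path) (u : π.Seed) : ℝ :=
  if π.Wins t ω u then π.bid t ω u else 0

/-- Budget feasibility: the total payment is at most `B = ρ T` for every realization. -/
def Strategy.BudgetFeasible (vbar ρ : ℝ) (T : ℕ) (π : Strategy) : Prop :=
  ∀ ω, Realizable vbar ω → ∀ u, ∑ t ∈ Finset.Icc 1 T, π.cost t ω u ≤ ρ * T

/-- The set of all budget feasible strategies. They may depend on `F` and `G`. -/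
def feasibleStrategies (vbar ρ : ℝ) (T : ℕ) : Set Strategy :=
  {π | π.Valid ∧ π.BudgetFeasible vbar ρ T}

/-- The performance `R(π)`: the expected total reward over values, competing bids and seed. -/
noncomputable def performance (F G : Measure ℝ) [IsProbabilityMeasure F] [IsProbabilityMeasure G]
    (T : ℕ) (π : Strategy) : ℝ :=
  ∫ z : Path × π.Seed, ∑ t ∈ Finset.Icc 1 T, π.reward t z.1 z.2 ∂((pathLaw F G).prod π.seedLaw)

/-- The regret against the best budget feasible strategy. -/
noncomputable def regret (vbar ρ : ℝ) (F G : Measure ℝ) [IsProbabilityMeasure F]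
    [IsProbabilityMeasure G] (T : ℕ) (π : Strategy) : ℝ :=
  sSup (performance F G T '' feasibleStrategies vbar ρ T) - performance F G T π

/-! The algorithm. It uses `vbar`, `ρ`, `T`, the step size `ε` and the past observations, but
neither `F` nor `G`. -/

/-- The empirical reward of bid `b` at value `v` in round `t`, from `d_1, …, d_{t-1}`. -/
noncomputable def empReward (ω : Path) (t : ℕ) (v b : ℝ) : ℝ :=
  1 / ((t : ℝ) - 1) * ∑ s ∈ Finset.Ico 1 t, if (ω s).2 ≤ b then v - b else 0

/-- The empirical cost of bid `b` in round `t`, from `d_1, …, d_{t-1}`. -/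
noncomputable def empCost (ω : Path) (t : ℕ) (b : ℝ) : ℝ :=
  1 / ((t : ℝ) - 1) * ∑ s ∈ Finset.Ico 1 t, if (ω s).2 ≤ b then b else 0

/-- The bids `b ≥ 0` that maximize the empirical cost-adjusted reward in round `t`. -/
def maximizers (ω : Path) (t : ℕ) (lam : ℝ) : Set ℝ :=
  {b | 0 ≤ b ∧ ∀ b', 0 ≤ b' →
    empReward ω t (ω t).1 b' - lam * empCost ω t b' ≤
      empReward ω t (ω t).1 b - lam * empCost ω t b}

/-- The smallest maximizer. For `t ≥ 2` and `lam ≥ 0` the objective is maximal over `b ≥ 0` at `0`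
or at some earlier `d_s`, and `maximizers` has a least element. -/
noncomputable def bestBid (ω : Path) (t : ℕ) (lam : ℝ) : ℝ :=
  sInf (maximizers ω t lam)

/-- The dual multiplier: `λ_2 = 0` and, for `t ≥ 2`, `λ_{t+1}` is the projection to the
nonnegative reals of `λ_t - ε (ρ - c̃_t(b_t))`. -/
noncomputable def algLam (ρ ε : ℝ) (ω : Path) : ℕ → ℝ
  | 0 => 0
  | t + 1 =>
    if t < 2 then 0
    else max 0 (algLam ρ ε ω t - ε * (ρ - empCost ω t (bestBid ω t (algLam ρ ε ω t))))

/-- The bid: `b_1 = 0`, and the smallest maximizer in the rounds `t ≥ 2`. -/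
noncomputable def algBid (ρ ε : ℝ) (ω : Path) (t : ℕ) : ℝ :=
  if t < 2 then 0 else bestBid ω t (algLam ρ ε ω t)

/-- The remaining budget: `B_2 = B` and `B_{t+1} = B_t - c_t` for `t ≥ 2`. -/
noncomputable def algBudget (ρ ε : ℝ) (T : ℕ) (ω : Path) : ℕ → ℝ
  | 0 => ρ * T
  | t + 1 =>
    if t < 2 then ρ * T
    else algBudget ρ ε T ω t - if (ω t).2 ≤ algBid ρ ε ω t then algBid ρ ε ω t else 0

/-- The loop has not been left before round `t`: it is left after the first round `s ≥ 2` with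
`B_{s+1} < vbar`. -/
def algRuns (vbar ρ ε : ℝ) (T : ℕ) (ω : Path) (t : ℕ) : Prop :=
  ∀ s, 2 ≤ s → s < t → vbar ≤ algBudget ρ ε T ω (s + 1)

/-- The algorithm as a deterministic strategy, which takes no part in the auctions any more once
the loop has been left. -/
noncomputable def algorithm (vbar ρ ε : ℝ) (T : ℕ) : Strategy where
  Seed := Unit
  seedLaw := Measure.dirac ()
  enter := fun t ω _ => algRuns vbar ρ ε T ω t
  bid := fun t ω _ => algBid ρ ε ω t

end FirstPrice

/-! The benchmark is controlled by Lagrangian duality. For `lam ≥ 0`, pricing payments at `lam` and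
the budget `ρ T` at the same rate can only favor a budget feasible strategy, and then the rounds
decouple: each is worth at most the expected best adjusted reward plus `lam * ρ`. So the optimal
value `R` satisfies `R / T ≤ dualValue lam` for all `lam ≥ 0` (`performance_le_dualValue`). Neither
strong duality nor a minimizing multiplier is needed: everything below works with an arbitrary lower
bound `V` of the dual function.

The algorithm optimizes the same Lagrangian with estimated winning probabilities. A quantile grid,
Hoeffding's inequality and a union bound make the estimate uniform over all bids
(`abs_empMass_Iic_sub_winProb_le`), at an expected cost of order `sqrt (log T / t)` in round `t`,
for arbitrary `G`. The multiplier `λ_t` and the decision to take part depend only on the past,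
whereas the value `v_t` is fresh. Hence, while the run lasts, the expected reward of a round is at
least that of `V - λ_t (ρ - c̃_t)`, up to the estimation error (`integral_lagrangian_le_reward`);
here `c̃_t` is the empirical cost of the chosen bid.

It remains to bound the sum of these terms pathwise (`le_sum_runs_mul_lagrangian`). The multipliers
follow projected gradient descent on `λ ↦ λ (ρ - c̃_t)`, so they are within order `sqrt T` of any
fixed comparator. If the run lasts to the end, the comparator `0` gives about `T V`. If it stops
early, the budget has been spent up to `vbar`, and the comparator `vbar / ρ` prices this spending at
about `vbar T`, which makes up for the missed rounds since `V ≤ vbar`. Passing from empirical costs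
to actual payments brings in the estimation errors and a martingale with second moment at most `T
vbar ^ 2`. -/

namespace FirstPrice

/-- The probability that a bid wins. -/
noncomputable def winProb (G : Measure ℝ) (b : ℝ) : ℝ := G.real (Set.Iic b)

theorem winProb_nonneg (G : Measure ℝ) (b : ℝ) : 0 ≤ winProb G b := measureReal_nonneg

section

variable (G : Measure ℝ) [IsProbabilityMeasure G]

theorem winProb_le_one (b : ℝ) : winProb G b ≤ 1 := measureReal_le_one

theorem monotone_winProb : Monotone (winProb G) :=
  fun _ _ h => measureReal_mono (Set.Iic_subset_Iic.2 h)

theorem measurable_winProb : Measurable (winProb G) := (monotone_winProb G).measurable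

end

/-! ### Resampling one round of the i.i.d. path -/

section Resampling

variable (F G : Measure ℝ) [IsProbabilityMeasure F] [IsProbabilityMeasure G]

instance instIsProbabilityMeasurePathLaw : IsProbabilityMeasure (pathLaw F G) := by
  unfold pathLaw; infer_instance

theorem measurable_update_path (t : ℕ) :
    Measurable (fun p : Path × (ℝ × ℝ) => Function.update p.1 t p.2) := by
  rw [measurable_pi_iff]
  intro s
  by_cases h : s = t
  · subst h; simpa using measurable_snd
  · simp only [Function.update_of_ne h]
    exact (measurable_pi_apply s).comp measurable_fst

/-- Replacing one coordinate by an independent copy does not change the law of the path. -/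
theorem map_update_pathLaw (t : ℕ) :
    ((pathLaw F G).prod (F.prod G)).map (fun p => Function.update p.1 t p.2) = pathLaw F G := by
  refine Measure.eq_infinitePi _ fun s A hA => ?_
  rw [Measure.map_apply (measurable_update_path t)
    (.pi s.countable_toSet fun i _ => hA i)]
  -- A box pulls back to a box: its `t`-th side constrains the fresh coordinate only, the other
  -- sides the old path.
  have hpre : (fun p : Path × (ℝ × ℝ) => Function.update p.1 t p.2) ⁻¹' ((s : Set ℕ).pi A) =
      (((s.erase t : Finset ℕ) : Set ℕ).pi A) ×ˢ (if t ∈ s then A t else Set.univ) := by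
    ext ⟨ω, x⟩
    simp only [Set.mem_preimage, Set.mem_pi, Set.mem_prod, Finset.mem_coe, Finset.mem_erase]
    constructor
    · intro h
      refine ⟨fun i hi => ?_, ?_⟩
      · simpa [Function.update_of_ne hi.1] using h i hi.2
      · split_ifs with ht
        · simpa using h t ht
        · trivial
    · rintro ⟨h1, h2⟩ i hi
      by_cases hit : i = t
      · subst hit; simpa [hi] using h2
      · simpa [Function.update_of_ne hit] using h1 i ⟨hit, hi⟩
  rw [hpre, Measure.prod_prod, pathLaw, Measure.infinitePi_pi _ (fun i _ => hA i)]
  split_ifs with ht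
  · rw [mul_comm, Finset.mul_prod_erase s (fun i => (F.prod G) (A i)) ht]
  · simp [Finset.erase_eq_of_notMem ht]

theorem integrable_resample {f : Path → ℝ} (hf : Integrable f (pathLaw F G)) (t : ℕ) :
    Integrable (fun p : Path × (ℝ × ℝ) => f (Function.update p.1 t p.2))
      ((pathLaw F G).prod (F.prod G)) := by
  rw [← map_update_pathLaw F G t] at hf
  exact hf.comp_measurable (measurable_update_path t)

/-- The inner integral plays the part of the conditional expectation given all rounds but `t`, so
that no filtration is needed. -/
theorem integral_resample {f : Path → ℝ} (hf : Integrable f (pathLaw F G)) (t : ℕ) :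
    ∫ ω, f ω ∂(pathLaw F G) =
      ∫ ω, ∫ x, f (Function.update ω t x) ∂(F.prod G) ∂(pathLaw F G) := by
  rw [← integral_prod _ (integrable_resample F G hf t)]
  conv_lhs => rw [← map_update_pathLaw F G t]
  rw [integral_map (measurable_update_path t).aemeasurable]
  rw [map_update_pathLaw F G t]
  exact hf.aestronglyMeasurable

theorem map_eval_pathLaw (t : ℕ) : (pathLaw F G).map (fun ω => ω t) = F.prod G :=
  Measure.infinitePi_map_eval _ t

theorem integral_value {f : ℝ → ℝ} (hf : Measurable f) (t : ℕ) :
    ∫ ω, f (ω t).1 ∂(pathLaw F G) = ∫ v, f v ∂F := by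
  have h1 : (pathLaw F G).map (fun ω => (ω t).1) = F := by
    have : (fun ω : Path => (ω t).1) = Prod.fst ∘ (fun ω : Path => ω t) := rfl
    rw [this, ← Measure.map_map measurable_fst (measurable_pi_apply t), map_eval_pathLaw]
    simp
  conv_rhs => rw [← h1]
  exact (integral_map (measurable_fst.comp (measurable_pi_apply t)).aemeasurable
    hf.aestronglyMeasurable).symm

theorem ae_realizable {vbar : ℝ} (hF : F (Set.Icc 0 vbar) = 1) (hG : G (Set.Ici 0) = 1) :
    ∀ᵐ ω ∂(pathLaw F G), Realizable vbar ω := by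
  refine ae_all_iff.2 fun t => ?_
  have h1 : ∀ᵐ x ∂(F.prod G), 0 ≤ x.1 ∧ x.1 ≤ vbar ∧ 0 ≤ x.2 := by
    have hf : ∀ᵐ v ∂F, v ∈ Set.Icc 0 vbar := (prob_compl_eq_zero_iff measurableSet_Icc).2 hF
    have hg : ∀ᵐ d ∂G, d ∈ Set.Ici (0 : ℝ) := (prob_compl_eq_zero_iff measurableSet_Ici).2 hG
    filter_upwards [Measure.quasiMeasurePreserving_fst.ae hf,
      Measure.quasiMeasurePreserving_snd.ae hg] with x hx hy
    exact ⟨hx.1, hx.2, hy⟩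
  rw [← map_eval_pathLaw F G t] at h1
  exact ae_of_ae_map (measurable_pi_apply t).aemeasurable h1

/-- The outcome of a bid that does not depend on the competing bid `d_t` is the winning
probability, in mean and against every factor that does not depend on `d_t` either. -/
theorem integral_mul_win_sub_winProb (h β : Path → ℝ) (t : ℕ)
    (h_inv : ∀ ω v d d', h (Function.update ω t (v, d)) = h (Function.update ω t (v, d')))
    (β_inv : ∀ ω v d d', β (Function.update ω t (v, d)) = β (Function.update ω t (v, d'))) :
    ∫ ω, h ω * ((if (ω t).2 ≤ β ω then 1 else 0) - winProb G (β ω)) ∂(pathLaw F G) = 0 := by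
  set k : Path → ℝ := fun ω => h ω * ((if (ω t).2 ≤ β ω then 1 else 0) - winProb G (β ω)) with hk
  by_cases hi : Integrable k (pathLaw F G)
  swap
  -- The integral of a non-integrable function is `0` by convention, which dispenses with
  -- integrability hypotheses on `h`.
  · exact integral_undef hi
  rw [integral_resample F G hi t]
  refine integral_eq_zero_of_ae (.of_forall fun ω => ?_)
  by_cases hi2 : Integrable (fun x => k (Function.update ω t x)) (F.prod G)
  swap
  · exact integral_undef hi2
  simp only [Pi.zero_apply]
  rw [integral_prod _ hi2]
  refine integral_eq_zero_of_ae (.of_forall fun v => ?_)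
  have h2 : ∀ d, k (Function.update ω t (v, d)) = h (Function.update ω t (v, 0)) *
      ((Set.Iic (β (Function.update ω t (v, 0)))).indicator 1 d -
        winProb G (β (Function.update ω t (v, 0)))) := by
    intro d
    simp only [hk]
    rw [h_inv ω v d 0, β_inv ω v d 0]
    simp [Set.indicator_apply]
  simp only [h2, Pi.zero_apply]
  rw [integral_const_mul, integral_sub, integral_indicator_one measurableSet_Iic]
  · simp [winProb]
  · exact (integrable_const (1 : ℝ)).indicator measurableSet_Iic
  · exact integrable_const _

end Resampling

/-! ### Quantile brackets for half-lines -/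

section Concentration

variable (G : Measure ℝ) [IsProbabilityMeasure G]

/-- Inner regularity. Half-lines need not contain their end point, but compact subsets attain their
extrema; this avoids a case distinction between open and closed ends. -/
theorem measureReal_le_of_forall_isCompact {S : Set ℝ} (hS : MeasurableSet S) {c : ℝ}
    (h : ∀ K, K ⊆ S → IsCompact K → G.real K ≤ c) : G.real S ≤ c := by
  have hc : 0 ≤ c := measureReal_nonneg.trans (h ∅ (Set.empty_subset _) isCompact_empty)
  refine ENNReal.toReal_le_of_le_ofReal hc ?_
  rw [hS.measure_eq_iSup_isCompact]
  refine iSup_le fun K => iSup_le fun hK => iSup_le fun hKc => ?_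
  rw [← ENNReal.ofReal_toReal (measure_ne_top G K)]
  exact ENNReal.ofReal_le_ofReal (h K hK hKc)

/-- The upper end of the `k`-th cell of the quantile grid with mesh `1 / n`. -/
def quantileBelow (n k : ℕ) : Set ℝ := {y | n * winProb G y < k + 1}

/-- The lower end of the `k`-th cell of the quantile grid with mesh `1 / n`. -/
def quantileAbove (n k : ℕ) : Set ℝ := {z | ∀ y, (k : ℝ) ≤ n * winProb G y → z ≤ y}

theorem measurableSet_quantileBelow (n k : ℕ) : MeasurableSet (quantileBelow G n k) :=
  measurableSet_lt ((measurable_winProb G).const_mul _) measurable_const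

theorem measurableSet_quantileAbove (G : Measure ℝ) (n k : ℕ) :
    MeasurableSet (quantileAbove G n k) := by
  have : Set.OrdConnected (quantileAbove G n k) := by
    refine ⟨fun x _ y hy z hz w hw => hz.2.trans (hy w hw)⟩
  exact this.measurableSet

theorem measureReal_quantileBelow_le {n : ℕ} (hn : 0 < n) (k : ℕ) :
    G.real (quantileBelow G n k) ≤ (k + 1) / n := by
  have hn' : (0 : ℝ) < n := by exact_mod_cast hn
  refine measureReal_le_of_forall_isCompact G (measurableSet_quantileBelow G n k)
    fun K hK hKc => ?_
  rcases K.eq_empty_or_nonempty with rfl | hne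
  · simp only [measureReal_empty]; positivity
  obtain ⟨m, hm, hmax⟩ := hKc.exists_isGreatest hne
  have h1 : G.real K ≤ winProb G m := measureReal_mono fun x hx => hmax hx
  have h2 : n * winProb G m < k + 1 := hK hm
  rw [le_div_iff₀ hn']
  nlinarith

/-- A compact subset of the complement has a least point, which lies strictly above some `y` with
winning probability at least `k / n`; so the whole subset misses `Set.Iic y`. -/
theorem le_measureReal_quantileAbove {n : ℕ} (hn : 0 < n) {k : ℕ} (hk : k ≤ n) :
    (k : ℝ) / n ≤ G.real (quantileAbove G n k) := by
  have hn' : (0 : ℝ) < n := by exact_mod_cast hn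
  have hk' : (k : ℝ) ≤ n := by exact_mod_cast hk
  have hm := measurableSet_quantileAbove G n k
  have h : G.real (quantileAbove G n k)ᶜ ≤ 1 - k / n := by
    refine measureReal_le_of_forall_isCompact G hm.compl fun K hK hKc => ?_
    rcases K.eq_empty_or_nonempty with rfl | hne
    · simp only [measureReal_empty, sub_nonneg]
      exact (div_le_one hn').2 hk'
    obtain ⟨m, hm, hmin⟩ := hKc.exists_isLeast hne
    have h1 : m ∉ quantileAbove G n k := hK hm
    simp only [quantileAbove, Set.mem_ofPred_eq, not_forall, not_le] at h1
    obtain ⟨y, hy, hym⟩ := h1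
    have h2 : G.real K ≤ G.real (Set.Iic y)ᶜ :=
      measureReal_mono fun x hx => by
        simpa using lt_of_lt_of_le hym (hmin hx)
    rw [probReal_compl_eq_one_sub measurableSet_Iic] at h2
    have h3 : (k : ℝ) / n ≤ winProb G y := by
      rw [div_le_iff₀ hn']; linarith
    unfold winProb at h3
    linarith
  rw [probReal_compl_eq_one_sub hm] at h
  linarith

/-- The finitely many lower sets that control all half-lines up to mass `1 / n`. -/
def quantileCell (n : ℕ) (i : ℕ × Bool) : Set ℝ :=
  if i.2 then quantileBelow G n i.1 else quantileAbove G n i.1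

theorem measurableSet_quantileCell (n : ℕ) (i : ℕ × Bool) :
    MeasurableSet (quantileCell G n i) := by
  unfold quantileCell
  split_ifs
  · exact measurableSet_quantileBelow G n _
  · exact measurableSet_quantileAbove G n _

/-- The index is the integer part of `n * winProb G b`. Atoms of `G` are harmless: the outer set has
mass at most `(k + 1) / n` and the inner one at least `k / n`, whatever `G` is. -/
theorem exists_quantileCell_sandwich {n : ℕ} (hn : 0 < n) (b : ℝ) :
    ∃ k ∈ Finset.range (n + 1), quantileCell G n (k, false) ⊆ Set.Iic b ∧
      Set.Iic b ⊆ quantileCell G n (k, true) ∧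
      G.real (quantileCell G n (k, true)) ≤ G.real (quantileCell G n (k, false)) + 1 / n := by
  have hn' : (0 : ℝ) < n := by exact_mod_cast hn
  have h0 : 0 ≤ n * winProb G b := mul_nonneg hn'.le (winProb_nonneg G b)
  have hle : ⌊n * winProb G b⌋₊ ≤ n := by
    refine Nat.floor_le_of_le ?_
    nlinarith [winProb_le_one G b]
  refine ⟨⌊n * winProb G b⌋₊, Finset.mem_range.2 (by omega), ?_, ?_, ?_⟩
  · intro z hz
    exact hz b (Nat.floor_le h0)
  · intro y hy
    have : n * winProb G y ≤ n * winProb G b :=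
      mul_le_mul_of_nonneg_left (monotone_winProb G hy) hn'.le
    exact this.trans_lt (Nat.lt_floor_add_one _)
  · have h1 := measureReal_quantileBelow_le G hn ⌊n * winProb G b⌋₊
    have h2 := le_measureReal_quantileAbove G hn hle
    rw [add_div] at h1
    simp only [quantileCell, if_true, Bool.false_eq_true, if_false]
    linarith

end Concentration

/-! ### Uniform error of the empirical winning probability -/

section EmpiricalMass

open ProbabilityTheory

/-- The fraction of the competing bids `d_1, …, d_{t-1}` that lie in `A`. -/
noncomputable def empMass (ω : Path) (t : ℕ) (A : Set ℝ) : ℝ :=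
  1 / ((t : ℝ) - 1) * ∑ s ∈ Finset.Ico 1 t, A.indicator 1 (ω s).2

theorem measurable_empMass {A : Set ℝ} (hA : MeasurableSet A) (t : ℕ) :
    Measurable (fun ω => empMass ω t A) := by
  unfold empMass
  refine Measurable.const_mul (Finset.measurable_sum _ fun s _ => ?_) _
  exact (measurable_one.indicator hA).comp (measurable_snd.comp (measurable_pi_apply s))

theorem empMass_nonneg (ω : Path) {t : ℕ} (ht : 2 ≤ t) (A : Set ℝ) : 0 ≤ empMass ω t A := by
  have h : (2 : ℝ) ≤ t := by exact_mod_cast ht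
  refine mul_nonneg (one_div_nonneg.2 (by linarith)) (Finset.sum_nonneg fun s _ => ?_)
  exact Set.indicator_nonneg (fun _ _ => zero_le_one) _

theorem empMass_mono (ω : Path) {t : ℕ} (ht : 2 ≤ t) {A B : Set ℝ} (h : A ⊆ B) :
    empMass ω t A ≤ empMass ω t B := by
  have h2 : (2 : ℝ) ≤ t := by exact_mod_cast ht
  refine mul_le_mul_of_nonneg_left (Finset.sum_le_sum fun s _ => ?_)
    (one_div_nonneg.2 (by linarith))
  exact Set.indicator_le_indicator_of_subset h (fun _ => zero_le_one) _

theorem empMass_le_one (ω : Path) {t : ℕ} (ht : 2 ≤ t) (A : Set ℝ) : empMass ω t A ≤ 1 := by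
  have h : (2 : ℝ) ≤ t := by exact_mod_cast ht
  refine (empMass_mono ω ht (Set.subset_univ A)).trans (le_of_eq ?_)
  have h1 : (t : ℝ) - 1 ≠ 0 := by linarith
  have h3 : ((t - 1 : ℕ) : ℝ) = t - 1 := by
    rw [Nat.cast_sub (by omega)]; simp
  simp [empMass, h3, h1]

variable (F G : Measure ℝ) [IsProbabilityMeasure F] [IsProbabilityMeasure G]

theorem map_competingBid_pathLaw (t : ℕ) : (pathLaw F G).map (fun ω => (ω t).2) = G := by
  have : (fun ω : Path => (ω t).2) = Prod.snd ∘ (fun ω : Path => ω t) := rfl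
  rw [this, ← Measure.map_map measurable_snd (measurable_pi_apply t), map_eval_pathLaw]
  simp

/-- Hoeffding's inequality: each centered summand takes values in an interval of length `1`, hence
is sub-Gaussian with parameter `1 / 4`. -/
theorem measureReal_empMass_sub_ge_le {f : ℝ → ℝ} (hf : Measurable f)
    (h01 : ∀ y, f y ∈ Set.Icc (0 : ℝ) 1) {t : ℕ} (ht : 2 ≤ t) {x : ℝ} (hx : 0 ≤ x) :
    (pathLaw F G).real {ω | ((t : ℝ) - 1) * x ≤
      ∑ s ∈ Finset.Ico 1 t, (f (ω s).2 - ∫ d, f d ∂G)} ≤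
      Real.exp (-2 * ((t : ℝ) - 1) * x ^ 2) := by
  have h2 : (2 : ℝ) ≤ t := by exact_mod_cast ht
  have hint : ∀ s, ∫ ω, f (ω s).2 ∂(pathLaw F G) = ∫ d, f d ∂G := by
    intro s
    conv_rhs => rw [← map_competingBid_pathLaw F G s]
    exact (integral_map (measurable_snd.comp (measurable_pi_apply s)).aemeasurable
      hf.aestronglyMeasurable).symm
  have hind : iIndepFun (fun (s : ℕ) (ω : Path) => f (ω s).2 - ∫ d, f d ∂G) (pathLaw F G) :=
    iIndepFun_infinitePi (P := fun _ : ℕ => F.prod G)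
      (X := fun _ x => f x.2 - ∫ d, f d ∂G) (fun _ => (hf.comp measurable_snd).sub_const _)
  have hsub : ∀ s ∈ Finset.Ico 1 t, HasSubgaussianMGF
      (fun ω : Path => f (ω s).2 - ∫ d, f d ∂G) ((‖(1 : ℝ) - 0‖₊ / 2) ^ 2) (pathLaw F G) := by
    intro s _
    have := hasSubgaussianMGF_of_mem_Icc (μ := pathLaw F G) (X := fun ω : Path => f (ω s).2)
      (a := 0) (b := 1)
      (hf.comp (measurable_snd.comp (measurable_pi_apply s))).aemeasurable
      (.of_forall fun ω => h01 _)
    rwa [hint s] at this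
  refine (HasSubgaussianMGF.measure_sum_ge_le_of_iIndepFun hind hsub
    (mul_nonneg (by linarith : (0 : ℝ) ≤ (t : ℝ) - 1) hx)).trans (le_of_eq ?_)
  congr 1
  have h3 : ((t - 1 : ℕ) : ℝ) = t - 1 := by
    rw [Nat.cast_sub (by omega)]; simp
  have h4 : (t : ℝ) - 1 ≠ 0 := by linarith
  have h5 : ((∑ _s ∈ Finset.Ico 1 t, (‖(1 : ℝ) - 0‖₊ / 2) ^ 2 : NNReal) : ℝ) =
      ((t : ℝ) - 1) / 4 := by
    rw [Finset.sum_const, Nat.card_Ico, nsmul_eq_mul, NNReal.coe_mul, NNReal.coe_natCast, h3]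
    simp only [sub_zero, nnnorm_one, NNReal.coe_pow, NNReal.coe_div, NNReal.coe_one,
      NNReal.coe_ofNat]
    ring
  rw [h5]
  field_simp
  norm_num

theorem measureReal_abs_empMass_sub_ge_le {A : Set ℝ} (hA : MeasurableSet A) {t : ℕ}
    (ht : 2 ≤ t) {x : ℝ} (hx : 0 ≤ x) :
    (pathLaw F G).real {ω | x ≤ |empMass ω t A - G.real A|} ≤
      2 * Real.exp (-2 * ((t : ℝ) - 1) * x ^ 2) := by
  have h2 : (2 : ℝ) ≤ t := by exact_mod_cast ht
  have hpos : (0 : ℝ) < (t : ℝ) - 1 := by linarith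
  have hm : Measurable (A.indicator (1 : ℝ → ℝ)) := measurable_one.indicator hA
  have hI : ∀ y, A.indicator (1 : ℝ → ℝ) y ∈ Set.Icc (0 : ℝ) 1 := by
    intro y
    by_cases hy : y ∈ A <;> simp [hy]
  have h1 := measureReal_empMass_sub_ge_le F G hm hI ht hx
  -- The lower tail for `A` is the upper tail for the indicator of its complement.
  have h1' := measureReal_empMass_sub_ge_le F G (f := fun y => 1 - A.indicator (1 : ℝ → ℝ) y)
    (measurable_const.sub hm)
    (fun y => ⟨by linarith [(hI y).2], by linarith [(hI y).1]⟩) ht hx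
  have hi : Integrable (A.indicator (1 : ℝ → ℝ)) G := (integrable_const (1 : ℝ)).indicator hA
  have e1 : ∫ d, A.indicator (1 : ℝ → ℝ) d ∂G = G.real A := integral_indicator_one hA
  have e2 : ∫ d, (1 - A.indicator (1 : ℝ → ℝ) d) ∂G = 1 - G.real A := by
    rw [integral_sub (integrable_const _) hi, e1]; simp
  have h3 : ((t - 1 : ℕ) : ℝ) = t - 1 := by
    rw [Nat.cast_sub (by omega)]; simp
  have key : ∀ ω : Path, ((t : ℝ) - 1) * (empMass ω t A - G.real A) =
      ∑ s ∈ Finset.Ico 1 t, (A.indicator (1 : ℝ → ℝ) (ω s).2 - G.real A) := by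
    intro ω
    rw [Finset.sum_sub_distrib]
    simp only [empMass, Finset.sum_const, Nat.card_Ico, nsmul_eq_mul, h3]
    field_simp
  have hsubset : {ω : Path | x ≤ |empMass ω t A - G.real A|} ⊆
      {ω | ((t : ℝ) - 1) * x ≤ ∑ s ∈ Finset.Ico 1 t,
        (A.indicator (1 : ℝ → ℝ) (ω s).2 - ∫ d, A.indicator (1 : ℝ → ℝ) d ∂G)} ∪
      {ω | ((t : ℝ) - 1) * x ≤ ∑ s ∈ Finset.Ico 1 t,
        ((1 - A.indicator (1 : ℝ → ℝ) (ω s).2) -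
          ∫ d, (1 - A.indicator (1 : ℝ → ℝ) d) ∂G)} := by
    intro ω hω
    rw [e1, e2]
    simp only [Set.mem_ofPred_eq] at hω
    rcases le_abs.1 hω with h | h
    · left
      simp only [Set.mem_ofPred_eq, ← key]
      exact mul_le_mul_of_nonneg_left h hpos.le
    · right
      have : ∑ s ∈ Finset.Ico 1 t, ((1 - A.indicator (1 : ℝ → ℝ) (ω s).2) - (1 - G.real A)) =
          ((t : ℝ) - 1) * (-(empMass ω t A - G.real A)) := by
        rw [mul_neg, key, ← Finset.sum_neg_distrib]
        exact Finset.sum_congr rfl fun s _ => by ring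
      simp only [Set.mem_ofPred_eq, this]
      exact mul_le_mul_of_nonneg_left h hpos.le
  calc _ ≤ _ := measureReal_mono hsubset
    _ ≤ _ := measureReal_union_le _ _
    _ ≤ _ := add_le_add h1 h1'
    _ = _ := by ring

/-- The confidence radius for round `t`. -/
noncomputable def confRadius (T t : ℕ) : ℝ := Real.sqrt (Real.log T / ((t : ℝ) - 1))

/-- A measurable bound for the uniform error of the empirical winning probability. -/
noncomputable def estError (G : Measure ℝ) (T t : ℕ) (ω : Path) : ℝ :=
  1 / T + confRadius T t + ∑ i ∈ Finset.range (T + 1) ×ˢ (Finset.univ : Finset Bool),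
    {ω : Path | confRadius T t ≤ |empMass ω t (quantileCell G T i) -
      G.real (quantileCell G T i)|}.indicator 1 ω

theorem measurableSet_deviation (T t : ℕ) (i : ℕ × Bool) :
    MeasurableSet {ω : Path | confRadius T t ≤ |empMass ω t (quantileCell G T i) -
      G.real (quantileCell G T i)|} := by
  have h := measurable_empMass (measurableSet_quantileCell G T i) t
  exact measurableSet_le measurable_const (h.sub_const _).abs

theorem confRadius_nonneg (T t : ℕ) : 0 ≤ confRadius T t := Real.sqrt_nonneg _

theorem estError_nonneg (G : Measure ℝ) (T t : ℕ) (ω : Path) : 0 ≤ estError G T t ω := by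
  refine add_nonneg (add_nonneg (by positivity) (confRadius_nonneg T t))
    (Finset.sum_nonneg fun i _ => Set.indicator_nonneg (fun _ _ => zero_le_one) _)

/-- Either the deviation is below the confidence radius, or the indicator of this cell adds `1`,
which bounds every difference of two masses. -/
theorem abs_empMass_quantileCell_sub_le {T : ℕ} {t : ℕ} (ht : 2 ≤ t) (ω : Path)
    {i : ℕ × Bool} (hi : i.1 ∈ Finset.range (T + 1)) :
    |empMass ω t (quantileCell G T i) - G.real (quantileCell G T i)| ≤
      estError G T t ω - 1 / T := by
  have hnn : ∀ j ∈ Finset.range (T + 1) ×ˢ (Finset.univ : Finset Bool),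
      0 ≤ {ω : Path | confRadius T t ≤ |empMass ω t (quantileCell G T j) -
      G.real (quantileCell G T j)|}.indicator (1 : Path → ℝ) ω :=
    fun j _ => Set.indicator_nonneg (fun _ _ => zero_le_one) _
  have hmem : i ∈ Finset.range (T + 1) ×ˢ (Finset.univ : Finset Bool) :=
    Finset.mem_product.2 ⟨hi, Finset.mem_univ _⟩
  have hsum := Finset.single_le_sum hnn hmem
  unfold estError
  by_cases h : confRadius T t ≤
      |empMass ω t (quantileCell G T i) - G.real (quantileCell G T i)|
  · rw [Set.indicator_of_mem (by exact h)] at hsum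
    have h1 : |empMass ω t (quantileCell G T i) - G.real (quantileCell G T i)| ≤ 1 := by
      have a1 := empMass_nonneg ω ht (quantileCell G T i)
      have a2 := empMass_le_one ω ht (quantileCell G T i)
      have a3 : 0 ≤ G.real (quantileCell G T i) := measureReal_nonneg
      have a4 : G.real (quantileCell G T i) ≤ 1 := measureReal_le_one
      rw [abs_le]; constructor <;> linarith
    have := confRadius_nonneg T t
    simp only [Pi.one_apply] at hsum
    linarith
  · have := Finset.sum_nonneg hnn
    linarith

/-- Both masses are monotone in the set, so the bracket transfers the error of its two ends to every
half-line; its mass gap is the summand `1 / T`. Uniformity in `b` matters because the bid depends on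
the same sample. -/
theorem abs_empMass_Iic_sub_winProb_le {T : ℕ} (hT : 0 < T) {t : ℕ} (ht : 2 ≤ t) (ω : Path)
    (b : ℝ) : |empMass ω t (Set.Iic b) - winProb G b| ≤ estError G T t ω := by
  obtain ⟨k, hk, h1, h2, h3⟩ := exists_quantileCell_sandwich G hT b
  have a1 := abs_le.1 (abs_empMass_quantileCell_sub_le G ht ω (i := (k, false)) hk)
  have a2 := abs_le.1 (abs_empMass_quantileCell_sub_le G ht ω (i := (k, true)) hk)
  have b1 := empMass_mono ω ht h1
  have b2 := empMass_mono ω ht h2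
  have c1 : G.real (quantileCell G T (k, false)) ≤ winProb G b := measureReal_mono h1
  have c2 : winProb G b ≤ G.real (quantileCell G T (k, true)) := measureReal_mono h2
  rw [abs_le]
  constructor <;> linarith [a1.1, a1.2, a2.1, a2.2]

theorem integrable_estError (T t : ℕ) : Integrable (estError G T t) (pathLaw F G) := by
  unfold estError
  refine (integrable_const _).add (integrable_finsetSum _ fun i _ => ?_)
  exact (integrable_const (1 : ℝ)).indicator (measurableSet_deviation G T t i)

theorem integral_estError_le {T : ℕ} (hT : 2 ≤ T) {t : ℕ} (ht : 2 ≤ t) :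
    ∫ ω, estError G T t ω ∂(pathLaw F G) ≤ confRadius T t + 7 / T := by
  have hT' : (2 : ℝ) ≤ T := by exact_mod_cast hT
  have ht' : (2 : ℝ) ≤ t := by exact_mod_cast ht
  have hind : ∀ i ∈ Finset.range (T + 1) ×ˢ (Finset.univ : Finset Bool), Integrable
      ({ω : Path | confRadius T t ≤ |empMass ω t (quantileCell G T i) -
      G.real (quantileCell G T i)|}.indicator (1 : Path → ℝ)) (pathLaw F G) := fun i _ =>
    (integrable_const (1 : ℝ)).indicator (measurableSet_deviation G T t i)
  -- The radius is chosen for this value: a failure probability of `2 / T ^ 2` per cell outweighs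
  -- the union over `2 (T + 1)` cells.
  have hexp : Real.exp (-2 * ((t : ℝ) - 1) * confRadius T t ^ 2) = 1 / (T : ℝ) ^ 2 := by
    have hlog : 0 ≤ Real.log T := Real.log_nonneg (by linarith)
    rw [confRadius, Real.sq_sqrt (div_nonneg hlog (by linarith))]
    have h1 : -2 * ((t : ℝ) - 1) * (Real.log T / ((t : ℝ) - 1)) = -(Real.log ((T : ℝ) ^ 2)) := by
      rw [Real.log_pow]
      have : (t : ℝ) - 1 ≠ 0 := by linarith
      push_cast
      field_simp
    rw [h1, Real.exp_neg, Real.exp_log (by positivity), one_div]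
  have hterm : ∀ i ∈ Finset.range (T + 1) ×ˢ (Finset.univ : Finset Bool),
      ∫ ω, {ω : Path | confRadius T t ≤ |empMass ω t (quantileCell G T i) -
      G.real (quantileCell G T i)|}.indicator (1 : Path → ℝ) ω ∂(pathLaw F G) ≤
        2 * (1 / (T : ℝ) ^ 2) := by
    intro i _
    rw [integral_indicator_one (measurableSet_deviation G T t i), ← hexp]
    exact measureReal_abs_empMass_sub_ge_le F G (measurableSet_quantileCell G T i) ht
      (confRadius_nonneg T t)
  unfold estError
  rw [integral_add (integrable_const _) (integrable_finsetSum _ hind),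
    integral_finsetSum _ hind]
  have hs := Finset.sum_le_sum hterm
  simp only [Finset.sum_const, Finset.card_product, Finset.card_range, Finset.card_univ,
    Fintype.card_bool, nsmul_eq_mul] at hs
  -- Equivalent to `4 ≤ 2 T`. With the mesh `1 / T` this makes `7 / T`.
  have hc : (((T + 1) * 2 : ℕ) : ℝ) * (2 * (1 / (T : ℝ) ^ 2)) ≤ 6 / T := by
    push_cast
    rw [← sub_nonneg]
    have : 6 / (T : ℝ) - ((T : ℝ) + 1) * 2 * (2 * (1 / (T : ℝ) ^ 2)) =
        (2 * T - 4) / (T : ℝ) ^ 2 := by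
      field_simp; ring
    rw [this]
    exact div_nonneg (by linarith) (by positivity)
  have h7 : (7 : ℝ) / T = 1 / T + 6 / T := by ring
  simp only [integral_const, probReal_univ, one_smul]
  rw [h7]
  linarith

theorem sum_integral_estError_le {T : ℕ} (hT : 2 ≤ T) :
    ∑ t ∈ Finset.Icc 2 T, ∫ ω, estError G T t ω ∂(pathLaw F G) ≤
      2 * Real.sqrt (T * Real.log T) + 7 := by
  have hT' : (2 : ℝ) ≤ T := by exact_mod_cast hT
  have hlog : 0 ≤ Real.log T := Real.log_nonneg (by linarith)
  have hsq : ∀ n : ℕ, ∑ t ∈ Finset.Icc 2 (n + 1), 1 / Real.sqrt ((t : ℝ) - 1) ≤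
      2 * Real.sqrt n := by
    intro n
    induction n with
    | zero => simp
    | succ n ih =>
      rw [Finset.sum_Icc_succ_top (by omega)]
      push_cast
      rw [add_sub_cancel_right]
      have hn : (0 : ℝ) ≤ n := Nat.cast_nonneg n
      have hb : 0 < Real.sqrt ((n : ℝ) + 1) := Real.sqrt_pos.2 (by linarith)
      have ha2 := Real.sq_sqrt hn
      have hb2 := Real.sq_sqrt (by linarith : (0 : ℝ) ≤ (n : ℝ) + 1)
      -- Telescoping comparison; after multiplication by the root it is `2 x y ≤ x ^ 2 + y ^ 2` for
      -- the two consecutive roots.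
      have : 1 / Real.sqrt ((n : ℝ) + 1) ≤
          2 * Real.sqrt ((n : ℝ) + 1) - 2 * Real.sqrt n := by
        rw [div_le_iff₀ hb]
        nlinarith [sq_nonneg (Real.sqrt ((n : ℝ) + 1) - Real.sqrt n)]
      linarith
  have h1 : ∀ t ∈ Finset.Icc 2 T, ∫ ω, estError G T t ω ∂(pathLaw F G) ≤
      Real.sqrt (Real.log T) * (1 / Real.sqrt ((t : ℝ) - 1)) + 7 / T := by
    intro t ht
    have := integral_estError_le F G hT (Finset.mem_Icc.1 ht).1
    rwa [confRadius, Real.sqrt_div hlog, div_eq_mul_one_div] at this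
  refine (Finset.sum_le_sum h1).trans ?_
  rw [Finset.sum_add_distrib, ← Finset.mul_sum, Finset.sum_const, Nat.card_Icc, nsmul_eq_mul,
    Real.sqrt_mul (by linarith : (0 : ℝ) ≤ T)]
  obtain ⟨n, rfl⟩ : ∃ n, T = n + 1 := ⟨T - 1, by omega⟩
  have h2 := mul_le_mul_of_nonneg_left (hsq n) (Real.sqrt_nonneg (Real.log ((n + 1 : ℕ) : ℝ)))
  have h3 : Real.sqrt n ≤ Real.sqrt ((n + 1 : ℕ) : ℝ) :=
    Real.sqrt_le_sqrt (by push_cast; linarith)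
  have h4 : ((n + 1 + 1 - 2 : ℕ) : ℝ) * (7 / ((n + 1 : ℕ) : ℝ)) ≤ 7 := by
    have : n + 1 + 1 - 2 = n := by omega
    rw [this, ← mul_div_assoc, div_le_iff₀ (by positivity)]
    push_cast
    linarith
  have h5 := mul_le_mul_of_nonneg_left h3 (Real.sqrt_nonneg (Real.log ((n + 1 : ℕ) : ℝ)))
  linarith

end EmpiricalMass

/-! ### Existence, size and measurability of the smallest maximizer -/

section BestBid

theorem empReward_eq (ω : Path) (t : ℕ) (v b : ℝ) :
    empReward ω t v b = (v - b) * empMass ω t (Set.Iic b) := by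
  unfold empReward empMass
  rw [mul_left_comm, Finset.mul_sum (a := v - b)]
  simp [Set.indicator_apply]

theorem empCost_eq (ω : Path) (t : ℕ) (b : ℝ) :
    empCost ω t b = b * empMass ω t (Set.Iic b) := by
  unfold empCost empMass
  rw [mul_left_comm, Finset.mul_sum (a := b)]
  simp [Set.indicator_apply]

/-- The empirical cost-adjusted reward of bid `b` in round `t`. -/
noncomputable def adjReward (ω : Path) (t : ℕ) (lam b : ℝ) : ℝ :=
  ((ω t).1 - (1 + lam) * b) * empMass ω t (Set.Iic b)

theorem empReward_sub_mul_empCost (ω : Path) (t : ℕ) (lam b : ℝ) :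
    empReward ω t (ω t).1 b - lam * empCost ω t b = adjReward ω t lam b := by
  rw [empReward_eq, empCost_eq, adjReward]; ring

theorem mem_maximizers {ω : Path} {t : ℕ} {lam b : ℝ} :
    b ∈ maximizers ω t lam ↔ 0 ≤ b ∧ ∀ b', 0 ≤ b' → adjReward ω t lam b' ≤ adjReward ω t lam b := by
  simp only [← empReward_sub_mul_empCost]
  rfl

/-- The bids at which the empirical winning probability jumps, and the bid `0`. -/
noncomputable def jumpBid (ω : Path) (s : ℕ) : ℝ := if s = 0 then 0 else max 0 (ω s).2

theorem jumpBid_nonneg (ω : Path) (s : ℕ) : 0 ≤ jumpBid ω s := by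
  unfold jumpBid; split_ifs
  · exact le_rfl
  · exact le_max_left _ _

/-- The empirical winning probability is a step function, constant from the largest jump point below
`b` up to `b`. The index `0`, which is not a round, stands for the bid `0` and makes such a point
exist. -/
theorem exists_jumpBid_le (ω : Path) {t : ℕ} (ht : 2 ≤ t) {b : ℝ} (hb : 0 ≤ b) :
    ∃ s ∈ Finset.range t, jumpBid ω s ≤ b ∧
      empMass ω t (Set.Iic (jumpBid ω s)) = empMass ω t (Set.Iic b) := by
  classical
  obtain ⟨s, hs, hmax⟩ := Finset.exists_max_image
    ((Finset.range t).filter fun s => jumpBid ω s ≤ b) (jumpBid ω)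
    ⟨0, Finset.mem_filter.2 ⟨Finset.mem_range.2 (by omega), by simpa [jumpBid] using hb⟩⟩
  rw [Finset.mem_filter] at hs
  refine ⟨s, hs.1, hs.2, ?_⟩
  unfold empMass
  congr 1
  refine Finset.sum_congr rfl fun r hr => ?_
  rw [Finset.mem_Ico] at hr
  have hr0 : r ≠ 0 := by omega
  have : (ω r).2 ∈ Set.Iic (jumpBid ω s) ↔ (ω r).2 ∈ Set.Iic b := by
    refine ⟨fun h => le_trans h hs.2, fun h => ?_⟩
    have h1 : jumpBid ω r ≤ b := by simpa [jumpBid, hr0] using ⟨hb, h⟩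
    have h2 := hmax r (Finset.mem_filter.2 ⟨Finset.mem_range.2 hr.2, h1⟩)
    refine le_trans ?_ h2
    simp [jumpBid, hr0]
  by_cases h : (ω r).2 ∈ Set.Iic b
  · rw [Set.indicator_of_mem h, Set.indicator_of_mem (this.2 h)]
  · rw [Set.indicator_of_notMem h, Set.indicator_of_notMem (fun h' => h (this.1 h'))]

/-- Lowering a bid to the last jump keeps the winning mass and does not reduce the margin. This
makes the maximization finite. -/
theorem exists_jumpBid_adjReward_le (ω : Path) {t : ℕ} (ht : 2 ≤ t) {lam : ℝ} (hlam : 0 ≤ lam)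
    {b : ℝ} (hb : 0 ≤ b) : ∃ s ∈ Finset.range t, jumpBid ω s ≤ b ∧
      adjReward ω t lam b ≤ adjReward ω t lam (jumpBid ω s) := by
  obtain ⟨s, hs, hsb, he⟩ := exists_jumpBid_le ω ht hb
  refine ⟨s, hs, hsb, ?_⟩
  unfold adjReward
  rw [he]
  refine mul_le_mul_of_nonneg_right ?_ (empMass_nonneg ω ht _)
  nlinarith

theorem jumpBid_mem_maximizers {ω : Path} {t : ℕ} (ht : 2 ≤ t) {lam : ℝ} (hlam : 0 ≤ lam) {s : ℕ} :
    jumpBid ω s ∈ maximizers ω t lam ↔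
      ∀ r ∈ Finset.range t, adjReward ω t lam (jumpBid ω r) ≤ adjReward ω t lam (jumpBid ω s) := by
  rw [mem_maximizers]
  refine ⟨fun h r _ => h.2 _ (jumpBid_nonneg ω r), fun h => ⟨jumpBid_nonneg ω s, fun b hb => ?_⟩⟩
  obtain ⟨r, hr, -, hle⟩ := exists_jumpBid_adjReward_le ω ht hlam hb
  exact hle.trans (h r hr)

theorem exists_isLeast_maximizers (ω : Path) {t : ℕ} (ht : 2 ≤ t) {lam : ℝ} (hlam : 0 ≤ lam) :
    ∃ s ∈ Finset.range t, IsLeast (maximizers ω t lam) (jumpBid ω s) := by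
  classical
  obtain ⟨s₀, hs₀, hmax⟩ := Finset.exists_max_image (Finset.range t)
    (fun s => adjReward ω t lam (jumpBid ω s)) ⟨0, Finset.mem_range.2 (by omega)⟩
  obtain ⟨s, hs, hmin⟩ := Finset.exists_min_image
    ((Finset.range t).filter fun s => jumpBid ω s ∈ maximizers ω t lam) (jumpBid ω)
    ⟨s₀, Finset.mem_filter.2 ⟨hs₀, (jumpBid_mem_maximizers ht hlam).2 hmax⟩⟩
  rw [Finset.mem_filter] at hs
  refine ⟨s, hs.1, hs.2, fun b hb => ?_⟩
  rw [mem_maximizers] at hb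
  obtain ⟨r, hr, hrb, hle⟩ := exists_jumpBid_adjReward_le ω ht hlam hb.1
  refine (hmin r (Finset.mem_filter.2 ⟨hr, ?_⟩)).trans hrb
  exact mem_maximizers.2 ⟨jumpBid_nonneg ω r, fun b' hb' => (hb.2 b' hb').trans hle⟩

theorem isLeast_bestBid (ω : Path) {t : ℕ} (ht : 2 ≤ t) {lam : ℝ} (hlam : 0 ≤ lam) :
    IsLeast (maximizers ω t lam) (bestBid ω t lam) := by
  obtain ⟨s, -, h⟩ := exists_isLeast_maximizers ω ht hlam
  rw [bestBid, h.csInf_eq]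
  exact h

/-- Describes the sublevel sets by finitely many comparisons, each measurable in the path; this
yields `measurable_bestBid`. -/
theorem bestBid_le_iff (ω : Path) {t : ℕ} (ht : 2 ≤ t) {lam : ℝ} (hlam : 0 ≤ lam) (x : ℝ) :
    bestBid ω t lam ≤ x ↔ ∃ s ∈ Finset.range t, jumpBid ω s ≤ x ∧
      ∀ r ∈ Finset.range t, adjReward ω t lam (jumpBid ω r) ≤ adjReward ω t lam (jumpBid ω s) := by
  constructor
  · intro h
    obtain ⟨s, hs, hl⟩ := exists_isLeast_maximizers ω ht hlam
    rw [bestBid, hl.csInf_eq] at h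
    exact ⟨s, hs, h, (jumpBid_mem_maximizers ht hlam).1 hl.1⟩
  · rintro ⟨s, -, hx, h⟩
    exact ((isLeast_bestBid ω ht hlam).2 ((jumpBid_mem_maximizers ht hlam).2 h)).trans hx

theorem bestBid_nonneg (ω : Path) (t : ℕ) (lam : ℝ) : 0 ≤ bestBid ω t lam :=
  Real.sInf_nonneg fun _ hb => (mem_maximizers.1 hb).1

theorem adjReward_le_bestBid (ω : Path) {t : ℕ} (ht : 2 ≤ t) {lam : ℝ} (hlam : 0 ≤ lam) {b : ℝ}
    (hb : 0 ≤ b) : adjReward ω t lam b ≤ adjReward ω t lam (bestBid ω t lam) :=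
  (mem_maximizers.1 (isLeast_bestBid ω ht hlam).1).2 b hb

/-- The best bid leaves a nonnegative cost-adjusted margin. -/
theorem one_add_mul_bestBid_le {ω : Path} {t : ℕ} (ht : 2 ≤ t) {lam : ℝ} (hlam : 0 ≤ lam)
    (hv : 0 ≤ (ω t).1) : (1 + lam) * bestBid ω t lam ≤ (ω t).1 := by
  have hl := isLeast_bestBid ω ht hlam
  have h0 := adjReward_le_bestBid ω ht hlam le_rfl
  have h00 : 0 ≤ adjReward ω t lam 0 := by
    unfold adjReward
    refine mul_nonneg (by simpa using hv) (empMass_nonneg ω ht _)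
  -- Without empirical wins the objective is `0` at the best bid, so the bid `0` is a maximizer too,
  -- and the choice of the smallest one excludes overbidding.
  rcases (empMass_nonneg ω ht (Set.Iic (bestBid ω t lam))).eq_or_lt with he | he
  · have hz : adjReward ω t lam (bestBid ω t lam) = 0 := by rw [adjReward, ← he, mul_zero]
    have : bestBid ω t lam ≤ 0 := hl.2 (mem_maximizers.2 ⟨le_rfl, fun b hb =>
      (adjReward_le_bestBid ω ht hlam hb).trans (hz.le.trans h00)⟩)
    rw [le_antisymm this (bestBid_nonneg ω t lam)]
    simpa using hv
  · by_contra! hlt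
    have : adjReward ω t lam (bestBid ω t lam) < 0 := mul_neg_of_neg_of_pos (by linarith) he
    linarith

theorem bestBid_le_value {ω : Path} {t : ℕ} (ht : 2 ≤ t) {lam : ℝ} (hlam : 0 ≤ lam)
    (hv : 0 ≤ (ω t).1) : bestBid ω t lam ≤ (ω t).1 := by
  nlinarith [one_add_mul_bestBid_le ht hlam hv, bestBid_nonneg ω t lam]

theorem measurable_jumpBid (s : ℕ) : Measurable (fun ω => jumpBid ω s) := by
  unfold jumpBid
  split_ifs
  · exact measurable_const
  · exact measurable_const.max (measurable_snd.comp (measurable_pi_apply s))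

theorem measurable_empMass_Iic (t : ℕ) {β : Path → ℝ} (hβ : Measurable β) :
    Measurable (fun ω => empMass ω t (Set.Iic (β ω))) := by
  unfold empMass
  refine Measurable.const_mul (Finset.measurable_sum _ fun s _ => ?_) _
  have h : MeasurableSet {ω : Path | (ω s).2 ≤ β ω} :=
    measurableSet_le (measurable_snd.comp (measurable_pi_apply s)) hβ
  have := (measurable_one (α := ℝ)).indicator h
  exact this

theorem measurable_adjReward (t : ℕ) {lam β : Path → ℝ} (hlam : Measurable lam)
    (hβ : Measurable β) : Measurable (fun ω => adjReward ω t (lam ω) (β ω)) := by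
  unfold adjReward
  exact (((measurable_fst.comp (measurable_pi_apply t)).sub
    ((measurable_const.add hlam).mul hβ))).mul (measurable_empMass_Iic t hβ)

theorem measurable_bestBid {t : ℕ} (ht : 2 ≤ t) {lam : Path → ℝ} (hlam : Measurable lam)
    (h0 : ∀ ω, 0 ≤ lam ω) : Measurable (fun ω => bestBid ω t (lam ω)) := by
  refine measurable_of_Iic fun x => ?_
  have : (fun ω => bestBid ω t (lam ω)) ⁻¹' Set.Iic x =
      ⋃ s ∈ Finset.range t, ({ω | jumpBid ω s ≤ x} ∩ ⋂ r ∈ Finset.range t,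
        {ω | adjReward ω t (lam ω) (jumpBid ω r) ≤ adjReward ω t (lam ω) (jumpBid ω s)}) := by
    ext ω
    simp only [Set.mem_preimage, Set.mem_Iic, bestBid_le_iff ω ht (h0 ω), Set.mem_iUnion,
      Set.mem_inter_iff, Set.mem_iInter, Set.mem_ofPred_eq, exists_prop]
  rw [this]
  refine Finset.measurableSet_biUnion _ fun s _ => ?_
  refine (measurableSet_le (measurable_jumpBid s) measurable_const).inter
    (Finset.measurableSet_biInter _ fun r _ => ?_)
  exact measurableSet_le (measurable_adjReward t hlam (measurable_jumpBid r))
    (measurable_adjReward t hlam (measurable_jumpBid s))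

theorem empMass_congr {ω ω' : Path} {t : ℕ} (h : ∀ s, 1 ≤ s → s < t → ω s = ω' s) (A : Set ℝ) :
    empMass ω t A = empMass ω' t A := by
  unfold empMass
  congr 1
  refine Finset.sum_congr rfl fun s hs => ?_
  rw [Finset.mem_Ico] at hs
  rw [h s hs.1 hs.2]

theorem bestBid_congr {ω ω' : Path} {t : ℕ} (h : ∀ s, 1 ≤ s → s < t → ω s = ω' s)
    (hv : (ω t).1 = (ω' t).1) (lam : ℝ) : bestBid ω t lam = bestBid ω' t lam := by
  have : maximizers ω t lam = maximizers ω' t lam := by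
    ext b
    simp only [mem_maximizers, adjReward, hv, empMass_congr h]
  rw [bestBid, bestBid, this]

end BestBid

/-! ### The algorithm as a strategy and its budget -/

section Algorithm

variable (vbar ρ ε : ℝ) (T : ℕ)

theorem algLam_nonneg (ω : Path) (t : ℕ) : 0 ≤ algLam ρ ε ω t := by
  cases t with
  | zero => exact le_rfl
  | succ t =>
    rw [algLam]
    split_ifs
    · exact le_rfl
    · exact le_max_left _ _

theorem algBid_of_two_le (ω : Path) {t : ℕ} (ht : 2 ≤ t) :
    algBid ρ ε ω t = bestBid ω t (algLam ρ ε ω t) := if_neg (by omega)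

theorem algLam_succ (ω : Path) {t : ℕ} (ht : 2 ≤ t) :
    algLam ρ ε ω (t + 1) =
      max 0 (algLam ρ ε ω t - ε * (ρ - empCost ω t (algBid ρ ε ω t))) := by
  rw [algLam, if_neg (by omega), algBid_of_two_le ρ ε ω ht]

theorem algLam_two (ω : Path) : algLam ρ ε ω 2 = 0 := by
  rw [algLam, if_pos (by omega)]

theorem algBid_nonneg (ω : Path) (t : ℕ) : 0 ≤ algBid ρ ε ω t := by
  unfold algBid; split_ifs
  · exact le_rfl
  · exact bestBid_nonneg _ _ _

theorem algBid_le_value {ω : Path} {t : ℕ} (hv : 0 ≤ (ω t).1) : algBid ρ ε ω t ≤ (ω t).1 := by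
  unfold algBid; split_ifs with h
  · exact hv
  · exact bestBid_le_value (by omega) (algLam_nonneg ρ ε ω t) hv

theorem measurable_algLam (t : ℕ) : Measurable (fun ω => algLam ρ ε ω t) := by
  induction t with
  | zero => exact measurable_const
  | succ t ih =>
    by_cases h : t < 2
    · simp only [algLam, h, if_true]; exact measurable_const
    · simp only [algLam, h, if_false, empCost_eq]
      have hb := measurable_bestBid (by omega : 2 ≤ t) ih (fun ω => algLam_nonneg ρ ε ω t)
      exact measurable_const.max (ih.sub (measurable_const.mul (measurable_const.sub
        (hb.mul (measurable_empMass_Iic t hb)))))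

theorem measurable_algBid (t : ℕ) : Measurable (fun ω => algBid ρ ε ω t) := by
  by_cases h : t < 2
  · simp only [algBid, h, if_true]; exact measurable_const
  · simp only [algBid, h, if_false]
    exact measurable_bestBid (by omega) (measurable_algLam ρ ε t)
      (fun ω => algLam_nonneg ρ ε ω t)

theorem measurable_algBudget (t : ℕ) : Measurable (fun ω => algBudget ρ ε T ω t) := by
  induction t with
  | zero => exact measurable_const
  | succ t ih =>
    by_cases h : t < 2
    · simp only [algBudget, h, if_true]; exact measurable_const
    · simp only [algBudget, h, if_false]
      exact ih.sub (Measurable.ite (measurableSet_le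
        (measurable_snd.comp (measurable_pi_apply t)) (measurable_algBid ρ ε t))
        (measurable_algBid ρ ε t) measurable_const)

theorem measurableSet_algRuns (t : ℕ) : MeasurableSet {ω | algRuns vbar ρ ε T ω t} := by
  have : {ω | algRuns vbar ρ ε T ω t} =
      ⋂ s ∈ {s : ℕ | 2 ≤ s ∧ s < t}, {ω | vbar ≤ algBudget ρ ε T ω (s + 1)} := by
    ext ω; simp [algRuns]
  rw [this]
  exact MeasurableSet.biInter (Set.to_countable _) fun s _ =>
    measurableSet_le measurable_const (measurable_algBudget ρ ε T (s + 1))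

variable {ω ω' : Path}

theorem algLam_congr {t : ℕ} (h : ∀ s, 1 ≤ s → s < t → ω s = ω' s) :
    algLam ρ ε ω t = algLam ρ ε ω' t := by
  induction t with
  | zero => rfl
  | succ t ih =>
    by_cases ht : t < 2
    · simp only [algLam, ht, if_true]
    · have h' : ∀ s, 1 ≤ s → s < t → ω s = ω' s := fun s h1 h2 => h s h1 (by omega)
      simp only [algLam, ht, if_false, empCost_eq]
      rw [ih h', bestBid_congr h' (by rw [h t (by omega) (by omega)]), empMass_congr h']

theorem algBid_congr {t : ℕ} (h : ∀ s, 1 ≤ s → s < t → ω s = ω' s)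
    (hv : (ω t).1 = (ω' t).1) : algBid ρ ε ω t = algBid ρ ε ω' t := by
  unfold algBid
  rw [algLam_congr ρ ε h, bestBid_congr h hv]

theorem algBudget_congr {t : ℕ} (h : ∀ s, 1 ≤ s → s < t → ω s = ω' s) :
    algBudget ρ ε T ω t = algBudget ρ ε T ω' t := by
  induction t with
  | zero => rfl
  | succ t ih =>
    by_cases ht : t < 2
    · simp only [algBudget, ht, if_true]
    · have h' : ∀ s, 1 ≤ s → s < t → ω s = ω' s := fun s h1 h2 => h s h1 (by omega)
      have ht' := h t (by omega) (by omega)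
      simp only [algBudget, ht, if_false]
      rw [ih h', algBid_congr ρ ε h' (by rw [ht']), ht']

theorem algRuns_congr {t : ℕ} (h : ∀ s, 1 ≤ s → s < t → ω s = ω' s) :
    algRuns vbar ρ ε T ω t ↔ algRuns vbar ρ ε T ω' t := by
  unfold algRuns
  refine forall_congr' fun s => forall_congr' fun _ => forall_congr' fun hs => ?_
  rw [algBudget_congr ρ ε T fun r h1 h2 => h r h1 (by omega)]

theorem algorithm_valid : (algorithm vbar ρ ε T).Valid where
  prob := by
    change IsProbabilityMeasure (Measure.dirac ())
    infer_instance
  measurable_enter t := measurable_fst (measurableSet_algRuns vbar ρ ε T t)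
  measurable_bid t := (measurable_algBid ρ ε t).comp measurable_fst
  bid_nonneg t ω _ := algBid_nonneg ρ ε ω t
  nonanticipating t ω ω' _ h hv := ⟨algRuns_congr vbar ρ ε T h, algBid_congr ρ ε h hv⟩

open Classical in
/-- The indicator of taking part in round `t`. -/
noncomputable def runs (ω : Path) (t : ℕ) : ℝ := if algRuns vbar ρ ε T ω t then 1 else 0

/-- The indicator of a sufficient bid in round `t`. -/
noncomputable def wins (ω : Path) (t : ℕ) : ℝ := if (ω t).2 ≤ algBid ρ ε ω t then 1 else 0

theorem algorithm_cost (t : ℕ) (u : Unit) :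
    (algorithm vbar ρ ε T).cost t ω u = runs vbar ρ ε T ω t * (algBid ρ ε ω t * wins ρ ε ω t) := by
  unfold Strategy.cost Strategy.Wins runs wins
  simp only [algorithm]
  by_cases h1 : algRuns vbar ρ ε T ω t <;> by_cases h2 : (ω t).2 ≤ algBid ρ ε ω t <;> simp [h1, h2]

theorem algorithm_reward (t : ℕ) (u : Unit) :
    (algorithm vbar ρ ε T).reward t ω u =
      runs vbar ρ ε T ω t * (((ω t).1 - algBid ρ ε ω t) * wins ρ ε ω t) := by
  unfold Strategy.reward Strategy.Wins runs wins
  simp only [algorithm]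
  by_cases h1 : algRuns vbar ρ ε T ω t <;> by_cases h2 : (ω t).2 ≤ algBid ρ ε ω t <;> simp [h1, h2]

theorem wins_nonneg (t : ℕ) : 0 ≤ wins ρ ε ω t := by
  unfold wins; split_ifs <;> norm_num

theorem wins_le_one (t : ℕ) : wins ρ ε ω t ≤ 1 := by
  unfold wins; split_ifs <;> norm_num

theorem runs_nonneg (t : ℕ) : 0 ≤ runs vbar ρ ε T ω t := by
  unfold runs; split_ifs <;> norm_num

theorem runs_le_one (t : ℕ) : runs vbar ρ ε T ω t ≤ 1 := by
  unfold runs; split_ifs <;> norm_num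

theorem algRuns_mono {s t : ℕ} (hst : s ≤ t) (h : algRuns vbar ρ ε T ω t) :
    algRuns vbar ρ ε T ω s := fun r h1 h2 => h r h1 (by omega)

theorem runs_antitone : Antitone (runs vbar ρ ε T ω) := by
  intro s t hst
  by_cases h : algRuns vbar ρ ε T ω t
  · rw [runs, runs, if_pos h, if_pos (algRuns_mono vbar ρ ε T hst h)]
  · rw [runs, if_neg h]; exact runs_nonneg vbar ρ ε T s

/-- The recursion goes on charging after the loop has been left, hence no factor `runs`. Only the
budget up to the first crossing of `vbar` is ever used. -/
theorem algBudget_succ_eq {n : ℕ} (hn : 1 ≤ n) :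
    algBudget ρ ε T ω (n + 1) =
      ρ * T - ∑ t ∈ Finset.Icc 2 n, algBid ρ ε ω t * wins ρ ε ω t := by
  induction n, hn using Nat.le_induction with
  | base => simp [algBudget]
  | succ n hn ih =>
    rw [Finset.sum_Icc_succ_top (by omega), algBudget, if_neg (by omega), ih]
    unfold wins
    split_ifs
    · rw [mul_one]; ring
    · rw [mul_zero]; ring

/-- As long as the run lasts, at least `vbar` is left, and no bid exceeds the value, so one more
payment cannot overdraw the budget. -/
theorem sum_runs_mul_cost_le {vbar : ℝ} (hv : vbar ≤ ρ * T) (hvbar : 0 ≤ vbar)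
    (hω : Realizable vbar ω) (n : ℕ) :
    ∑ t ∈ Finset.Icc 2 n, runs vbar ρ ε T ω t * (algBid ρ ε ω t * wins ρ ε ω t) ≤ ρ * T := by
  induction n with
  | zero => simp; linarith
  | succ n ih =>
    rcases Nat.lt_or_ge n 1 with h | h
    · have : n = 0 := by omega
      subst this; simp; linarith
    rw [Finset.sum_Icc_succ_top (by omega)]
    by_cases hr : algRuns vbar ρ ε T ω (n + 1)
    · have hone : ∀ t ∈ Finset.Icc 2 n, runs vbar ρ ε T ω t * (algBid ρ ε ω t * wins ρ ε ω t) =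
          algBid ρ ε ω t * wins ρ ε ω t := by
        intro t ht
        rw [runs, if_pos (algRuns_mono vbar ρ ε T (by have := (Finset.mem_Icc.1 ht).2; omega) hr),
          one_mul]
      rw [Finset.sum_congr rfl hone, runs, if_pos hr, one_mul]
      -- Before round `2` no stopping test has taken place; there the hypothesis `vbar ≤ ρ * T` is
      -- needed.
      have hb : vbar ≤ algBudget ρ ε T ω (n + 1) := by
        rcases h.eq_or_lt with h1 | h1
        · subst h1; simpa [algBudget] using hv
        · exact hr n (by omega) (by omega)
      rw [algBudget_succ_eq ρ ε T h] at hb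
      have h1 := algBid_le_value ρ ε (hω (n + 1)).1
      have h2 := (hω (n + 1)).2.1
      have h3 := wins_le_one ρ ε (ω := ω) (n + 1)
      have h4 := algBid_nonneg ρ ε ω (n + 1)
      nlinarith
    · rw [runs, if_neg hr, zero_mul, add_zero]; exact ih

theorem sum_Icc_one_eq {T : ℕ} (hT : 1 ≤ T) (f : ℕ → ℝ) :
    ∑ t ∈ Finset.Icc 1 T, f t = f 1 + ∑ t ∈ Finset.Icc 2 T, f t := by
  rw [← Finset.insert_Icc_add_one_left_eq_Icc hT, Finset.sum_insert (by simp)]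
  rfl

theorem algorithm_budgetFeasible {vbar : ℝ} (hv : vbar ≤ ρ * T) (hvbar : 0 ≤ vbar) :
    (algorithm vbar ρ ε T).BudgetFeasible vbar ρ T := by
  intro ω hω u
  rcases Nat.eq_zero_or_pos T with rfl | hT
  · simp
  rw [sum_Icc_one_eq hT]
  simp only [algorithm_cost vbar ρ ε T _ u]
  have h1 : algBid ρ ε ω 1 = 0 := if_pos (by omega)
  rw [h1, zero_mul, mul_zero, zero_add]
  exact sum_runs_mul_cost_le ρ ε T hv hvbar hω T

/-- A run that ends early has spent the budget up to `vbar`. -/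
theorem le_sum_cost_of_not_algRuns {vbar : ℝ} (h : ¬ algRuns vbar ρ ε T ω T) :
    ρ * T - vbar ≤
      ∑ t ∈ Finset.Icc 2 T, runs vbar ρ ε T ω t * (algBid ρ ε ω t * wins ρ ε ω t) := by
  classical
  have hex : ∃ s, 2 ≤ s ∧ s < T ∧ algBudget ρ ε T ω (s + 1) < vbar := by
    simpa [algRuns] using h
  obtain ⟨h2, hsT, hlt⟩ := Nat.find_spec hex
  set s := Nat.find hex with hs
  -- In the first round `s` whose test fails the bidder still takes part, so all payments up to `s`
  -- are real.
  have hruns : algRuns vbar ρ ε T ω s := by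
    intro r hr1 hr2
    by_contra! hr
    exact Nat.find_min hex hr2 ⟨hr1, by omega, hr⟩
  rw [algBudget_succ_eq ρ ε T (by omega)] at hlt
  have hone : ∑ t ∈ Finset.Icc 2 s, runs vbar ρ ε T ω t * (algBid ρ ε ω t * wins ρ ε ω t) =
      ∑ t ∈ Finset.Icc 2 s, algBid ρ ε ω t * wins ρ ε ω t := by
    refine Finset.sum_congr rfl fun t ht => ?_
    rw [runs, if_pos (algRuns_mono vbar ρ ε T (Finset.mem_Icc.1 ht).2 hruns), one_mul]
  have hsub : ∑ t ∈ Finset.Icc 2 s, runs vbar ρ ε T ω t * (algBid ρ ε ω t * wins ρ ε ω t) ≤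
      ∑ t ∈ Finset.Icc 2 T, runs vbar ρ ε T ω t * (algBid ρ ε ω t * wins ρ ε ω t) := by
    refine Finset.sum_le_sum_of_subset_of_nonneg (Finset.Icc_subset_Icc le_rfl hsT.le)
      fun t _ _ => ?_
    exact mul_nonneg (runs_nonneg vbar ρ ε T t)
      (mul_nonneg (algBid_nonneg ρ ε ω t) (wins_nonneg ρ ε t))
  linarith

end Algorithm

/-! ### The dual function and weak duality -/

section Dual

variable (G : Measure ℝ) [IsProbabilityMeasure G] (vbar : ℝ)

/-- The best expected cost-adjusted reward at the multiplier `p.1` and the value `p.2`. -/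
noncomputable def bestAdjReward (p : ℝ × ℝ) : ℝ :=
  ⨆ b : Set.Icc 0 vbar, (p.2 - (1 + p.1) * b) * winProb G b

theorem bddAbove_adjReward (p : ℝ × ℝ) :
    BddAbove (Set.range fun b : Set.Icc 0 vbar => (p.2 - (1 + p.1) * b) * winProb G b) := by
  refine ⟨|p.2| + |1 + p.1| * vbar, ?_⟩
  rintro _ ⟨b, rfl⟩
  have h0 := winProb_nonneg G b
  have h1 := winProb_le_one G b
  have h2 : p.2 - (1 + p.1) * b ≤ |p.2| + |1 + p.1| * vbar := by
    have a1 := le_abs_self p.2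
    have a2 := neg_abs_le (1 + p.1)
    have a3 := abs_nonneg (1 + p.1)
    nlinarith [b.2.1, b.2.2]
  have h3 : 0 ≤ |p.2| + |1 + p.1| * vbar :=
    add_nonneg (abs_nonneg _) (mul_nonneg (abs_nonneg _) (b.2.1.trans b.2.2))
  dsimp only
  nlinarith

theorem le_bestAdjReward (p : ℝ × ℝ) {b : ℝ} (hb : b ∈ Set.Icc 0 vbar) :
    (p.2 - (1 + p.1) * b) * winProb G b ≤ bestAdjReward G vbar p :=
  le_ciSup (bddAbove_adjReward G vbar p) ⟨b, hb⟩

variable {vbar}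

theorem bestAdjReward_le (G : Measure ℝ) (hv : 0 ≤ vbar) {p : ℝ × ℝ} {c : ℝ}
    (h : ∀ b ∈ Set.Icc 0 vbar, (p.2 - (1 + p.1) * b) * winProb G b ≤ c) :
    bestAdjReward G vbar p ≤ c := by
  have : Nonempty (Set.Icc 0 vbar) := ⟨⟨0, le_rfl, hv⟩⟩
  exact ciSup_le fun b => h b b.2

/-- An uncountable supremum, but of functions of `(lam, v)` that share the Lipschitz constant `1 +
vbar`, hence Lipschitz itself. -/
theorem measurable_bestAdjReward (hv : 0 ≤ vbar) : Measurable (bestAdjReward G vbar) := by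
  have h : LipschitzWith (1 + vbar).toNNReal (bestAdjReward G vbar) := by
    refine LipschitzWith.of_le_add_mul _ fun p q => bestAdjReward_le G hv fun b hb => ?_
    refine le_trans ?_ (add_le_add_left (le_bestAdjReward G vbar q hb) _)
    rw [Real.coe_toNNReal _ (by linarith)]
    have h1 : |p.1 - q.1| ≤ dist p q := by
      rw [← Real.dist_eq]; exact (le_max_left _ _)
    have h2 : |p.2 - q.2| ≤ dist p q := by
      rw [← Real.dist_eq]; exact (le_max_right _ _)
    have h3 := le_abs_self (p.2 - q.2)
    have h4 := neg_abs_le (p.1 - q.1)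
    have h5 : (p.2 - q.2) - (p.1 - q.1) * b ≤ (1 + vbar) * dist p q := by
      have := dist_nonneg (x := p) (y := q)
      nlinarith [hb.1, hb.2]
    have h6 : 0 ≤ (1 + vbar) * dist p q := mul_nonneg (by linarith) dist_nonneg
    nlinarith [winProb_nonneg G b, winProb_le_one G b]
  exact h.continuous.measurable

theorem bestAdjReward_nonneg (hv : 0 ≤ vbar) {p : ℝ × ℝ} (h : 0 ≤ p.2) :
    0 ≤ bestAdjReward G vbar p := by
  refine le_trans ?_ (le_bestAdjReward G vbar p ⟨le_rfl, hv⟩)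
  rw [mul_zero, sub_zero]
  exact mul_nonneg h (winProb_nonneg G 0)

theorem bestAdjReward_le_value (hv : 0 ≤ vbar) {p : ℝ × ℝ} (h : 0 ≤ p.2) (h1 : 0 ≤ p.1) :
    bestAdjReward G vbar p ≤ p.2 := by
  refine bestAdjReward_le G hv fun b hb => ?_
  have := mul_nonneg (by linarith : 0 ≤ 1 + p.1) hb.1
  nlinarith [winProb_nonneg G b, winProb_le_one G b]

variable (F : Measure ℝ) [IsProbabilityMeasure F]

theorem integrable_of_realizable (hF : F (Set.Icc 0 vbar) = 1) (hG : G (Set.Ici 0) = 1)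
    {f : Path → ℝ} (hf : Measurable f) (C : ℝ) (h : ∀ ω, Realizable vbar ω → |f ω| ≤ C) :
    Integrable f (pathLaw F G) :=
  .of_bound hf.aestronglyMeasurable C ((ae_realizable F G hF hG).mono h)

theorem integrable_bestAdjReward (hv : 0 ≤ vbar) (hF : F (Set.Icc 0 vbar) = 1) {lam : ℝ}
    (hlam : 0 ≤ lam) : Integrable (fun v => bestAdjReward G vbar (lam, v)) F := by
  refine .of_bound ((measurable_bestAdjReward G hv).comp
    measurable_prodMk_left).aestronglyMeasurable vbar ?_
  have hf : ∀ᵐ v ∂F, v ∈ Set.Icc 0 vbar := (prob_compl_eq_zero_iff measurableSet_Icc).2 hF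
  filter_upwards [hf] with v hv'
  rw [Real.norm_eq_abs, abs_of_nonneg (bestAdjReward_nonneg G hv (p := (lam, v)) hv'.1)]
  exact (bestAdjReward_le_value G hv (p := (lam, v)) hv'.1 hlam).trans hv'.2

/-- The per-round value of the Lagrangian relaxation at the multiplier `lam`. -/
noncomputable def dualValue (vbar ρ lam : ℝ) : ℝ :=
  ∫ v, bestAdjReward G vbar (lam, v) ∂F + lam * ρ

theorem dualValue_nonneg (hv : 0 ≤ vbar) {ρ lam : ℝ} (hρ : 0 ≤ ρ) (hlam : 0 ≤ lam)
    (hF : F (Set.Icc 0 vbar) = 1) : 0 ≤ dualValue G F vbar ρ lam := by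
  have hf : ∀ᵐ v ∂F, v ∈ Set.Icc 0 vbar := (prob_compl_eq_zero_iff measurableSet_Icc).2 hF
  refine add_nonneg (integral_nonneg_of_ae ?_) (mul_nonneg hlam hρ)
  filter_upwards [hf] with v hv'
  exact bestAdjReward_nonneg G hv (p := (lam, v)) hv'.1

theorem dualValue_zero_le (hv : 0 ≤ vbar) (ρ : ℝ) (hF : F (Set.Icc 0 vbar) = 1) :
    dualValue G F vbar ρ 0 ≤ vbar := by
  have hf : ∀ᵐ v ∂F, v ∈ Set.Icc 0 vbar := (prob_compl_eq_zero_iff measurableSet_Icc).2 hF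
  rw [dualValue, zero_mul, add_zero]
  have : ∫ v, bestAdjReward G vbar (0, v) ∂F ≤ ∫ _, vbar ∂F := by
    refine integral_mono_ae (integrable_bestAdjReward G F hv hF le_rfl) (integrable_const _) ?_
    filter_upwards [hf] with v hv'
    exact (bestAdjReward_le_value G hv (p := (0, v)) hv'.1 le_rfl).trans hv'.2
  simpa using this

variable {F}

/-- For a fixed seed, the expected cost-adjusted reward of a round is at most that of the best
bid. -/
theorem integral_adjReward_round_le (hv : 0 ≤ vbar) (hF : F (Set.Icc 0 vbar) = 1)
    (hG : G (Set.Ici 0) = 1) {lam : ℝ} (hlam : 0 ≤ lam) {π : Strategy} (hπ : π.Valid)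
    (u : π.Seed) (t : ℕ) : ∃ k : Path → ℝ, Integrable k (pathLaw F G) ∧
      (∀ ω, Realizable vbar ω → π.reward t ω u - lam * π.cost t ω u ≤ k ω) ∧
      ∫ ω, k ω ∂(pathLaw F G) ≤ ∫ v, bestAdjReward G vbar (lam, v) ∂F := by
  classical
  set b : Path → ℝ := fun ω => π.bid t ω u with hb
  have hbm : Measurable b := (hπ.measurable_bid t).comp measurable_prodMk_right
  have hem : MeasurableSet {ω | π.enter t ω u} :=
    measurable_prodMk_right (hπ.measurable_enter t)
  -- Bids of an arbitrary strategy may be unbounded and their rewards not integrable. Bids above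
  -- `vbar` have a nonpositive margin, so replacing it by `0` gives a bounded majorant.
  set h : Path → ℝ := fun ω =>
    if π.enter t ω u ∧ b ω ≤ vbar then (ω t).1 - (1 + lam) * b ω else 0 with hh
  have hvm : Measurable fun ω : Path => (ω t).1 := measurable_fst.comp (measurable_pi_apply t)
  have hhm : Measurable h := Measurable.ite (hem.inter (measurableSet_le hbm measurable_const))
    (hvm.sub (hbm.const_mul _)) measurable_const
  have hwm : Measurable fun ω : Path => if (ω t).2 ≤ b ω then (1 : ℝ) else 0 :=
    Measurable.ite (measurableSet_le (measurable_snd.comp (measurable_pi_apply t)) hbm)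
      measurable_const measurable_const
  have hgm : Measurable fun ω => winProb G (b ω) := (measurable_winProb G).comp hbm
  have hbound : ∀ ω, Realizable vbar ω → |h ω| ≤ vbar + (1 + lam) * vbar := by
    intro ω hω
    have h0 : 0 ≤ b ω := hπ.bid_nonneg t ω u
    have h1 := hω t
    have h2 : 0 ≤ (1 + lam) * vbar := mul_nonneg (by linarith) hv
    simp only [hh]
    split_ifs with hc
    · have h3 : (1 + lam) * b ω ≤ (1 + lam) * vbar :=
        mul_le_mul_of_nonneg_left hc.2 (by linarith)
      have h4 : 0 ≤ (1 + lam) * b ω := mul_nonneg (by linarith) h0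
      rw [abs_le]; constructor <;> linarith [h1.1, h1.2.1]
    · rw [abs_zero]; linarith
  have hupd : ∀ ω v d d', (π.enter t (Function.update ω t (v, d)) u ↔
      π.enter t (Function.update ω t (v, d')) u) ∧
      b (Function.update ω t (v, d)) = b (Function.update ω t (v, d')) := by
    intro ω v d d'
    refine hπ.nonanticipating t _ _ u (fun s _ hs => ?_) (by simp)
    simp [Function.update_of_ne hs.ne]
  -- Entry, bid and value do not depend on `d_t`, so the win may be replaced by its probability.
  have hzero := integral_mul_win_sub_winProb F G h b t
    (fun ω v d d' => by simp only [hh, (hupd ω v d d').1, (hupd ω v d d').2, Function.update_self])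
    (fun ω v d d' => (hupd ω v d d').2)
  have hk : Integrable (fun ω => h ω * if (ω t).2 ≤ b ω then (1 : ℝ) else 0) (pathLaw F G) := by
    refine integrable_of_realizable G F hF hG (hhm.mul hwm) (vbar + (1 + lam) * vbar)
      fun ω hω => ?_
    rw [abs_mul]
    refine le_trans (mul_le_of_le_one_right (abs_nonneg _) ?_) (hbound ω hω)
    split_ifs <;> simp
  have hk' : Integrable (fun ω => h ω * winProb G (b ω)) (pathLaw F G) := by
    refine integrable_of_realizable G F hF hG (hhm.mul hgm) (vbar + (1 + lam) * vbar)
      fun ω hω => ?_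
    rw [abs_mul]
    refine le_trans (mul_le_of_le_one_right (abs_nonneg _) ?_) (hbound ω hω)
    rw [abs_of_nonneg (winProb_nonneg G _)]
    exact winProb_le_one G _
  refine ⟨_, hk, fun ω hω => ?_, ?_⟩
  · have h0 : 0 ≤ b ω := hπ.bid_nonneg t ω u
    have hv1 := (hω t).2.1
    have hbv : ¬ b ω ≤ vbar → (ω t).1 - (1 + lam) * b ω ≤ 0 := by
      intro hc
      nlinarith [mul_nonneg hlam h0]
    have hbid : π.bid t ω u = b ω := rfl
    simp only [Strategy.reward, Strategy.cost, Strategy.Wins, hh, hbid]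
    by_cases he : π.enter t ω u <;> by_cases hw : (ω t).2 ≤ b ω <;>
      by_cases hc : b ω ≤ vbar <;> simp [he, hw, hc]
    · linarith
    · linarith [hbv hc]
  · have hsub : ∫ ω, (h ω * if (ω t).2 ≤ b ω then (1 : ℝ) else 0) ∂(pathLaw F G) =
        ∫ ω, h ω * winProb G (b ω) ∂(pathLaw F G) := by
      refine sub_eq_zero.1 ((integral_sub hk hk').symm.trans (Eq.trans ?_ hzero))
      exact integral_congr_ae (.of_forall fun ω => (mul_sub _ _ _).symm)
    have hφm : Measurable fun v => bestAdjReward G vbar (lam, v) :=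
      (measurable_bestAdjReward G hv).comp measurable_prodMk_left
    rw [hsub, ← integral_value F G hφm t]
    refine integral_mono_ae hk' ?_ ?_
    · refine integrable_of_realizable G F hF hG (hφm.comp hvm) vbar fun ω hω => ?_
      rw [abs_of_nonneg (bestAdjReward_nonneg G hv (p := (lam, (ω t).1)) (hω t).1)]
      exact (bestAdjReward_le_value G hv (p := (lam, (ω t).1)) (hω t).1 hlam).trans (hω t).2.1
    · filter_upwards [ae_realizable F G hF hG] with ω hω
      simp only [hh]
      split_ifs with hc
      · exact le_bestAdjReward G vbar (lam, (ω t).1) ⟨hπ.bid_nonneg t ω u, hc.2⟩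
      · rw [zero_mul]
        exact bestAdjReward_nonneg G hv (p := (lam, (ω t).1)) (hω t).1

/-- Weak duality: no budget feasible strategy beats the Lagrangian relaxation. -/
theorem performance_le_dualValue (hv : 0 ≤ vbar) (hF : F (Set.Icc 0 vbar) = 1)
    (hG : G (Set.Ici 0) = 1) {ρ : ℝ} (hρ : 0 ≤ ρ) {lam : ℝ} (hlam : 0 ≤ lam) {T : ℕ}
    {π : Strategy} (hπ : π ∈ feasibleStrategies vbar ρ T) :
    performance F G T π ≤ T * dualValue G F vbar ρ lam := by
  obtain ⟨hval, hfeas⟩ := hπ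
  have := hval.prob
  have hc : 0 ≤ T * dualValue G F vbar ρ lam :=
    mul_nonneg (Nat.cast_nonneg _) (dualValue_nonneg G F hv hρ hlam hF)
  unfold performance
  by_cases hi : Integrable (fun z : Path × π.Seed => ∑ t ∈ Finset.Icc 1 T, π.reward t z.1 z.2)
    ((pathLaw F G).prod π.seedLaw)
  swap
  -- A non-integrable total has performance `0` by convention, and the dual value is nonnegative.
  · rw [integral_undef hi]; exact hc
  -- For a fixed seed the strategy is deterministic, and the bound holds seed by seed.
  rw [integral_prod_symm _ hi]
  have hle : ∀ u, ∫ ω, ∑ t ∈ Finset.Icc 1 T, π.reward t ω u ∂(pathLaw F G) ≤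
      T * dualValue G F vbar ρ lam := by
    intro u
    by_cases hiu : Integrable (fun ω => ∑ t ∈ Finset.Icc 1 T, π.reward t ω u) (pathLaw F G)
    swap
    · rw [integral_undef hiu]; exact hc
    choose k hk hle hint using fun t =>
      integral_adjReward_round_le G hv hF hG hlam hval u t
    have hsum : Integrable (fun ω => ∑ t ∈ Finset.Icc 1 T, k t ω) (pathLaw F G) :=
      integrable_finsetSum _ fun t _ => hk t
    calc ∫ ω, ∑ t ∈ Finset.Icc 1 T, π.reward t ω u ∂(pathLaw F G)
        ≤ ∫ ω, (∑ t ∈ Finset.Icc 1 T, k t ω + lam * (ρ * T)) ∂(pathLaw F G) := by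
          refine integral_mono_ae hiu (hsum.add (integrable_const _)) ?_
          filter_upwards [ae_realizable F G hF hG] with ω hω
          have h1 := mul_le_mul_of_nonneg_left (hfeas ω hω u) hlam
          have h2 := Finset.sum_le_sum fun t (_ : t ∈ Finset.Icc 1 T) => hle t ω hω
          rw [Finset.sum_sub_distrib, ← Finset.mul_sum] at h2
          linarith
      _ = ∑ t ∈ Finset.Icc 1 T, ∫ ω, k t ω ∂(pathLaw F G) + lam * (ρ * T) := by
          rw [integral_add hsum (integrable_const _), integral_finsetSum _ fun t _ => hk t]
          simp
      _ ≤ ∑ t ∈ Finset.Icc 1 T, ∫ v, bestAdjReward G vbar (lam, v) ∂F + lam * (ρ * T) :=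
          add_le_add_left (Finset.sum_le_sum fun t _ => hint t) _
      _ = T * dualValue G F vbar ρ lam := by
          rw [Finset.sum_const, Nat.card_Icc, nsmul_eq_mul, dualValue]
          simp only [Nat.add_sub_cancel]
          ring
  calc _ ≤ ∫ _, T * dualValue G F vbar ρ lam ∂π.seedLaw :=
        integral_mono hi.integral_prod_right (integrable_const _) hle
    _ = _ := by simp

end Dual

/-! ### Pathwise bounds along the run -/

section Pathwise

variable (G : Measure ℝ) [IsProbabilityMeasure G] {vbar ρ ε : ℝ} {T : ℕ} {ω : Path}

/-- Up to the estimation error, the bid of the algorithm earns the best adjusted reward. -/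
theorem bestAdjReward_add_le (hω : Realizable vbar ω) (hT : 0 < T) {t : ℕ} (ht : 2 ≤ t) :
    bestAdjReward G vbar (algLam ρ ε ω t, (ω t).1) +
        algLam ρ ε ω t * empCost ω t (algBid ρ ε ω t) - 2 * vbar * estError G T t ω ≤
      ((ω t).1 - algBid ρ ε ω t) * winProb G (algBid ρ ε ω t) := by
  have hlam := algLam_nonneg ρ ε ω t
  have hv := hω t
  rw [algBid_of_two_le ρ ε ω ht, empCost_eq]
  set lam := algLam ρ ε ω t
  set b := bestBid ω t lam with hb
  have hb0 : 0 ≤ b := bestBid_nonneg ω t lam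
  have hbv : (1 + lam) * b ≤ (ω t).1 := one_add_mul_bestBid_le ht hlam hv.1
  have hbv' : b ≤ (ω t).1 := bestBid_le_value ht hlam hv.1
  have hΔ := estError_nonneg G T t ω
  have hm := empMass_nonneg ω ht (Set.Iic b)
  have hdev : ∀ b', _ := fun b' => abs_le.1 (abs_empMass_Iic_sub_winProb_le G hT ht ω b')
  have h1 : bestAdjReward G vbar (lam, (ω t).1) ≤
      ((ω t).1 - (1 + lam) * b) * empMass ω t (Set.Iic b) + vbar * estError G T t ω := by
    refine bestAdjReward_le G (hv.1.trans hv.2.1) fun b' hb' => ?_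
    dsimp only
    -- Only competitors with a positive margin matter. That margin is at most `vbar` for every
    -- `lam`, so the estimation error is not multiplied by the multiplier.
    rcases le_or_gt ((ω t).1 - (1 + lam) * b') 0 with hneg | hpos
    · have a1 : ((ω t).1 - (1 + lam) * b') * winProb G b' ≤ 0 :=
        mul_nonpos_of_nonpos_of_nonneg hneg (winProb_nonneg G b')
      have a2 := mul_nonneg (sub_nonneg.2 hbv) hm
      have a3 := mul_nonneg (hv.1.trans hv.2.1) hΔ
      linarith
    · have a1 := adjReward_le_bestBid ω ht hlam hb'.1
      unfold adjReward at a1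
      have a2 : ((ω t).1 - (1 + lam) * b') * winProb G b' ≤
          ((ω t).1 - (1 + lam) * b') * (empMass ω t (Set.Iic b') + estError G T t ω) :=
        mul_le_mul_of_nonneg_left (by linarith [(hdev b').1]) hpos.le
      have a3 : ((ω t).1 - (1 + lam) * b') * estError G T t ω ≤ vbar * estError G T t ω := by
        refine mul_le_mul_of_nonneg_right ?_ hΔ
        have := mul_nonneg (by linarith : 0 ≤ 1 + lam) hb'.1
        linarith [hv.2.1]
      linarith
  -- The second `vbar * estError`: only the reward returns to true probabilities. The priced cost
  -- stays empirical, as in the update of the multiplier.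
  have h2 : ((ω t).1 - b) * (empMass ω t (Set.Iic b) - estError G T t ω) ≤
      ((ω t).1 - b) * winProb G b :=
    mul_le_mul_of_nonneg_left (by linarith [(hdev b).2]) (by linarith)
  have h3 : ((ω t).1 - b) * estError G T t ω ≤ vbar * estError G T t ω :=
    mul_le_mul_of_nonneg_right (by linarith [hv.2.1]) hΔ
  linarith

theorem empCost_algBid_nonneg {t : ℕ} (ht : 2 ≤ t) : 0 ≤ empCost ω t (algBid ρ ε ω t) := by
  rw [empCost_eq]
  exact mul_nonneg (algBid_nonneg ρ ε ω t) (empMass_nonneg ω ht _)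

theorem empCost_algBid_le (hω : Realizable vbar ω) {t : ℕ} (ht : 2 ≤ t) :
    empCost ω t (algBid ρ ε ω t) ≤ vbar := by
  rw [empCost_eq]
  have h1 := algBid_le_value ρ ε (hω t).1
  have h2 := algBid_nonneg ρ ε ω t
  nlinarith [empMass_nonneg ω ht (Set.Iic (algBid ρ ε ω t)),
    empMass_le_one ω ht (Set.Iic (algBid ρ ε ω t)), (hω t).2.1]

/-- A crude bound, needed for integrability only. -/
theorem algLam_le (hω : Realizable vbar ω) (hρ : 0 ≤ ρ) (hε : 0 ≤ ε) (t : ℕ) :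
    algLam ρ ε ω t ≤ ε * vbar * t := by
  have hv : 0 ≤ vbar := (hω 0).1.trans (hω 0).2.1
  induction t with
  | zero => simp [algLam]
  | succ t ih =>
    have h0 : 0 ≤ ε * vbar * ((t + 1 : ℕ) : ℝ) := by positivity
    by_cases h : t < 2
    · rw [algLam, if_pos h]; exact h0
    · rw [algLam_succ ρ ε ω (by omega)]
      refine max_le h0 ?_
      have h1 := empCost_algBid_le (ρ := ρ) (ε := ε) hω (by omega : 2 ≤ t)
      have h2 := mul_le_mul_of_nonneg_left h1 hε
      have h3 := mul_nonneg hε hρ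
      push_cast
      linarith

/-- The regret of projected online gradient descent up to the stopping time of the run. -/
theorem sum_runs_mul_sub_mul_le (hω : Realizable vbar ω) (hρ : 0 ≤ ρ) (hρv : ρ ≤ vbar)
    (hε : 0 < ε) {lam : ℝ} (hlam : 0 ≤ lam) (n : ℕ) :
    ∑ t ∈ Finset.Icc 2 n, runs vbar ρ ε T ω t *
      ((algLam ρ ε ω t - lam) * (ρ - empCost ω t (algBid ρ ε ω t))) ≤
      lam ^ 2 / (2 * ε) + ε * n * vbar ^ 2 / 2 := by
  have hA : 0 ≤ lam ^ 2 / (2 * ε) := by positivity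
  rcases Nat.eq_zero_or_pos n with rfl | hn
  · simpa using hA
  -- The induction carries the squared distance to the comparator as a potential, weighted by `runs`
  -- so as to vanish after the stop.
  suffices h : ∑ t ∈ Finset.Icc 2 n, runs vbar ρ ε T ω t *
      ((algLam ρ ε ω t - lam) * (ρ - empCost ω t (algBid ρ ε ω t))) ≤
      (lam ^ 2 - runs vbar ρ ε T ω n * (algLam ρ ε ω (n + 1) - lam) ^ 2) / (2 * ε) +
        ε * n * vbar ^ 2 / 2 by
    refine h.trans (add_le_add_left (div_le_div_of_nonneg_right ?_ (by positivity)) _)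
    have := mul_nonneg (runs_nonneg vbar ρ ε T (ω := ω) n) (sq_nonneg (algLam ρ ε ω (n + 1) - lam))
    linarith
  induction n, hn using Nat.le_induction with
  | base =>
    have h1 := runs_le_one vbar ρ ε T (ω := ω) 1
    rw [algLam_two]
    have h2 : 0 ≤ (lam ^ 2 - runs vbar ρ ε T ω 1 * (0 - lam) ^ 2) / (2 * ε) := by
      refine div_nonneg ?_ (by positivity)
      nlinarith [sq_nonneg lam]
    have h3 : 0 ≤ ε * (1 : ℕ) * vbar ^ 2 / 2 := by positivity
    simpa using add_nonneg h2 h3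
  | succ n hn ih =>
    rw [Finset.sum_Icc_succ_top (by omega)]
    set L := algLam ρ ε ω (n + 1)
    set L' := algLam ρ ε ω (n + 1 + 1) with hL'
    set g := ρ - empCost ω (n + 1) (algBid ρ ε ω (n + 1)) with hg
    have hg2 : g ^ 2 ≤ vbar ^ 2 := by
      have h1 := empCost_algBid_le (ρ := ρ) (ε := ε) hω (by omega : 2 ≤ n + 1)
      have h2 := empCost_algBid_nonneg (ω := ω) (ρ := ρ) (ε := ε) (by omega : 2 ≤ n + 1)
      exact sq_le_sq' (by linarith) (by linarith)
    -- Projection to the nonnegative reals does not move away from `lam ≥ 0`.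
    have hstep : (L' - lam) ^ 2 ≤ (L - ε * g - lam) ^ 2 := by
      rw [hL', algLam_succ ρ ε ω (by omega)]
      rcases le_total 0 (L - ε * g) with h | h
      · rw [max_eq_right h]
      · rw [max_eq_left h]
        nlinarith
    have he0 := runs_nonneg vbar ρ ε T (ω := ω) (n + 1)
    have he1 := runs_le_one vbar ρ ε T (ω := ω) (n + 1)
    have hmono := runs_antitone vbar ρ ε T (ω := ω) (Nat.le_succ n)
    set e' := runs vbar ρ ε T ω (n + 1)
    set e := runs vbar ρ ε T ω n
    have hcore : 2 * ε * (e' * ((L - lam) * g)) ≤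
        e * (L - lam) ^ 2 - e' * (L' - lam) ^ 2 + ε ^ 2 * vbar ^ 2 := by
      have a1 : 2 * ε * ((L - lam) * g) ≤ (L - lam) ^ 2 - (L' - lam) ^ 2 + ε ^ 2 * g ^ 2 := by
        linarith
      have a2 := mul_le_mul_of_nonneg_left a1 he0
      -- Taking part is nonincreasing in time, so the weight of the potential can only drop.
      have a3 := mul_le_mul_of_nonneg_right hmono (sq_nonneg (L - lam))
      have a4 : e' * (ε ^ 2 * g ^ 2) ≤ ε ^ 2 * vbar ^ 2 := by
        have a5 : ε ^ 2 * g ^ 2 ≤ ε ^ 2 * vbar ^ 2 :=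
          mul_le_mul_of_nonneg_left hg2 (sq_nonneg ε)
        have a6 : 0 ≤ ε ^ 2 * g ^ 2 := by positivity
        nlinarith
      linarith
    have hdiv : e' * ((L - lam) * g) ≤
        (e * (L - lam) ^ 2 - e' * (L' - lam) ^ 2) / (2 * ε) + ε * vbar ^ 2 / 2 := by
      have : (e * (L - lam) ^ 2 - e' * (L' - lam) ^ 2) / (2 * ε) + ε * vbar ^ 2 / 2 =
          (e * (L - lam) ^ 2 - e' * (L' - lam) ^ 2 + ε ^ 2 * vbar ^ 2) / (2 * ε) := by
        field_simp
      rw [this, le_div_iff₀ (by positivity)]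
      linarith
    refine (add_le_add ih hdiv).trans (le_of_eq ?_)
    push_cast
    field_simp
    ring

/-- The deviation of the cost of round `t` from its conditional mean. -/
noncomputable def costNoise (G : Measure ℝ) (vbar ρ ε : ℝ) (T : ℕ) (ω : Path) (t : ℕ) : ℝ :=
  runs vbar ρ ε T ω t * algBid ρ ε ω t * (wins ρ ε ω t - winProb G (algBid ρ ε ω t))

/-- The Lagrangian gain collected along the run falls short of `T * V` by lower order terms. -/
theorem le_sum_runs_mul_lagrangian (hω : Realizable vbar ω) (hρ : 0 < ρ) (hρv : ρ ≤ vbar)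
    (hε : 0 < ε) (hT : 2 ≤ T) {V : ℝ} (hV : V ≤ vbar) :
    T * V - (vbar + vbar / ρ * vbar + (vbar / ρ) ^ 2 / (2 * ε) + ε * T * vbar ^ 2 / 2 +
        vbar / ρ * vbar * ∑ t ∈ Finset.Icc 2 T, estError G T t ω +
        vbar / ρ * |∑ t ∈ Finset.Icc 2 T, costNoise G vbar ρ ε T ω t|) ≤
      ∑ t ∈ Finset.Icc 2 T, runs vbar ρ ε T ω t *
        (V - algLam ρ ε ω t * (ρ - empCost ω t (algBid ρ ε ω t))) := by
  have hv : 0 < vbar := hρ.trans_le hρv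
  have hT0 : (2 : ℝ) ≤ T := by exact_mod_cast hT
  -- The comparator for an early stop: at this price the whole budget `ρ T` is worth `vbar T`, an
  -- upper bound for `T V`.
  set l := vbar / ρ with hl
  have hl0 : 0 < l := div_pos hv hρ
  have hlρ : l * ρ = vbar := div_mul_cancel₀ _ hρ.ne'
  have hΔ : 0 ≤ ∑ t ∈ Finset.Icc 2 T, estError G T t ω :=
    Finset.sum_nonneg fun t _ => estError_nonneg G T t ω
  have hΔ' := mul_nonneg (mul_nonneg hl0.le hv.le) hΔ
  have hM := abs_nonneg (∑ t ∈ Finset.Icc 2 T, costNoise G vbar ρ ε T ω t)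
  have hM' := mul_nonneg hl0.le hM
  have hl2 : 0 ≤ l ^ 2 / (2 * ε) := by positivity
  have hcard : ∑ _t ∈ Finset.Icc 2 T, (1 : ℝ) = T - 1 := by
    rw [Finset.sum_const, Nat.card_Icc, nsmul_eq_mul, mul_one, Nat.cast_sub (by omega)]
    push_cast; ring
  have hlv := mul_pos hl0 hv
  by_cases hr : algRuns vbar ρ ε T ω T
  · have hone : ∀ t ∈ Finset.Icc 2 T, runs vbar ρ ε T ω t = 1 := fun t ht =>
      if_pos (algRuns_mono vbar ρ ε T (Finset.mem_Icc.1 ht).2 hr)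
    -- A full run is compared with `0`; besides the descent error only the first round is lost,
    -- worth at most `vbar`.
    have hogd := sum_runs_mul_sub_mul_le (T := T) hω hρ.le hρv hε le_rfl T
    have hsplit : ∑ t ∈ Finset.Icc 2 T, runs vbar ρ ε T ω t *
        (V - algLam ρ ε ω t * (ρ - empCost ω t (algBid ρ ε ω t))) =
        (T - 1) * V - ∑ t ∈ Finset.Icc 2 T, runs vbar ρ ε T ω t *
          ((algLam ρ ε ω t - 0) * (ρ - empCost ω t (algBid ρ ε ω t))) := by
      rw [← hcard, Finset.sum_mul, ← Finset.sum_sub_distrib]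
      refine Finset.sum_congr rfl fun t ht => ?_
      rw [hone t ht]; ring
    rw [hsplit]
    have hz : (0 : ℝ) ^ 2 / (2 * ε) = 0 := by simp
    rw [hz] at hogd
    linarith
  · have hogd := sum_runs_mul_sub_mul_le (T := T) hω hρ.le hρv hε hl0.le T
    have hspent := le_sum_cost_of_not_algRuns ρ ε T hr
    have hN : ∑ t ∈ Finset.Icc 2 T, runs vbar ρ ε T ω t ≤ T - 1 := by
      rw [← hcard]
      exact Finset.sum_le_sum fun t _ => runs_le_one vbar ρ ε T t
    have hsplit : ∑ t ∈ Finset.Icc 2 T, runs vbar ρ ε T ω t *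
        (V - algLam ρ ε ω t * (ρ - empCost ω t (algBid ρ ε ω t))) =
        (∑ t ∈ Finset.Icc 2 T, runs vbar ρ ε T ω t) * (V - vbar) +
        l * ∑ t ∈ Finset.Icc 2 T, runs vbar ρ ε T ω t * empCost ω t (algBid ρ ε ω t) -
        ∑ t ∈ Finset.Icc 2 T, runs vbar ρ ε T ω t *
          ((algLam ρ ε ω t - l) * (ρ - empCost ω t (algBid ρ ε ω t))) := by
      rw [Finset.sum_mul, Finset.mul_sum, ← Finset.sum_add_distrib, ← Finset.sum_sub_distrib]
      refine Finset.sum_congr rfl fun t _ => ?_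
      rw [← hlρ]; ring
    -- From actual payments to conditional means (`costNoise`), and from these to empirical costs
    -- (`estError`).
    have hcost : ∑ t ∈ Finset.Icc 2 T, runs vbar ρ ε T ω t * (algBid ρ ε ω t * wins ρ ε ω t) -
        vbar * ∑ t ∈ Finset.Icc 2 T, estError G T t ω -
        ∑ t ∈ Finset.Icc 2 T, costNoise G vbar ρ ε T ω t ≤
        ∑ t ∈ Finset.Icc 2 T, runs vbar ρ ε T ω t * empCost ω t (algBid ρ ε ω t) := by
      rw [Finset.mul_sum, ← Finset.sum_sub_distrib, ← Finset.sum_sub_distrib]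
      refine Finset.sum_le_sum fun t ht => ?_
      have ht2 := (Finset.mem_Icc.1 ht).1
      have hd := (abs_le.1 (abs_empMass_Iic_sub_winProb_le G (by omega : 0 < T) ht2 ω
        (algBid ρ ε ω t))).1
      have hb0 := algBid_nonneg ρ ε ω t
      have hbv := (algBid_le_value ρ ε (hω t).1).trans (hω t).2.1
      have he0 := runs_nonneg vbar ρ ε T (ω := ω) t
      have he1 := runs_le_one vbar ρ ε T (ω := ω) t
      have h1 : runs vbar ρ ε T ω t * algBid ρ ε ω t ≤ vbar := by nlinarith
      have h2 := mul_nonneg he0 hb0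
      have h3 := mul_le_mul_of_nonneg_left hd h2
      have h4 := mul_le_mul_of_nonneg_right h1 (estError_nonneg G T t ω)
      rw [empCost_eq, costNoise]
      linarith
    rw [hsplit]
    have h1 := mul_le_mul_of_nonneg_left hcost hl0.le
    have h2 := mul_le_mul_of_nonneg_left hspent hl0.le
    have h3 := mul_le_mul_of_nonneg_left
      (le_abs_self (∑ t ∈ Finset.Icc 2 T, costNoise G vbar ρ ε T ω t)) hl0.le
    -- Stopping early is harmless here because `V - vbar ≤ 0`: fewer rounds give a larger sum.
    have h4 : (T : ℝ) * (V - vbar) ≤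
        (∑ t ∈ Finset.Icc 2 T, runs vbar ρ ε T ω t) * (V - vbar) := by
      nlinarith
    have h5 : l * (ρ * T - vbar) = vbar * T - l * vbar := by rw [← hlρ]; ring
    linarith

end Pathwise

/-! ### Expectations: martingale noise and the performance bound -/

section Expectation

variable {F G : Measure ℝ} [IsProbabilityMeasure F] [IsProbabilityMeasure G]
  {vbar ρ ε : ℝ} {T : ℕ}

theorem measurable_runs (t : ℕ) : Measurable (fun ω => runs vbar ρ ε T ω t) := by
  classical
  exact Measurable.ite (measurableSet_algRuns vbar ρ ε T t) measurable_const measurable_const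

theorem measurable_wins (t : ℕ) : Measurable (fun ω => wins ρ ε ω t) :=
  Measurable.ite (measurableSet_le (measurable_snd.comp (measurable_pi_apply t))
    (measurable_algBid ρ ε t)) measurable_const measurable_const

theorem measurable_value (t : ℕ) : Measurable (fun ω : Path => (ω t).1) :=
  measurable_fst.comp (measurable_pi_apply t)

theorem measurable_empCost_algBid (t : ℕ) :
    Measurable (fun ω => empCost ω t (algBid ρ ε ω t)) := by
  simp only [empCost_eq]
  exact (measurable_algBid ρ ε t).mul (measurable_empMass_Iic t (measurable_algBid ρ ε t))

theorem measurable_winProb_algBid (t : ℕ) :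
    Measurable (fun ω => winProb G (algBid ρ ε ω t)) :=
  (measurable_winProb G).comp (measurable_algBid ρ ε t)

theorem measurable_costNoise (t : ℕ) :
    Measurable (fun ω => costNoise G vbar ρ ε T ω t) :=
  ((measurable_runs t).mul (measurable_algBid ρ ε t)).mul
    ((measurable_wins t).sub (measurable_winProb_algBid t))

theorem runs_congr {ω ω' : Path} {t : ℕ} (h : ∀ s, 1 ≤ s → s < t → ω s = ω' s) :
    runs vbar ρ ε T ω t = runs vbar ρ ε T ω' t := by
  classical
  unfold runs
  exact if_congr (algRuns_congr vbar ρ ε T h) rfl rfl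

theorem wins_congr {ω ω' : Path} {t : ℕ} (h : ∀ s, 1 ≤ s → s < t → ω s = ω' s)
    (ht : ω t = ω' t) : wins ρ ε ω t = wins ρ ε ω' t := by
  unfold wins
  rw [algBid_congr ρ ε h (by rw [ht]), ht]

theorem costNoise_congr {G : Measure ℝ} {ω ω' : Path} {t : ℕ} (h : ∀ s, 1 ≤ s → s < t → ω s = ω' s)
    (ht : ω t = ω' t) : costNoise G vbar ρ ε T ω t = costNoise G vbar ρ ε T ω' t := by
  unfold costNoise
  rw [algBid_congr ρ ε h (by rw [ht]), wins_congr h ht, runs_congr h]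

theorem update_eq_update {ω : Path} {t : ℕ} (x y : ℝ × ℝ) (s : ℕ) (hs : s < t) :
    Function.update ω t x s = Function.update ω t y s := by
  simp [Function.update_of_ne hs.ne]

theorem algBid_update (ω : Path) (t : ℕ) (v d d' : ℝ) :
    algBid ρ ε (Function.update ω t (v, d)) t = algBid ρ ε (Function.update ω t (v, d')) t :=
  algBid_congr ρ ε (fun s _ hs => update_eq_update _ _ s hs) (by simp)

theorem runs_update (ω : Path) (t : ℕ) (x y : ℝ × ℝ) :
    runs vbar ρ ε T (Function.update ω t x) t = runs vbar ρ ε T (Function.update ω t y) t :=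
  runs_congr (fun s _ hs => update_eq_update _ _ s hs)

theorem abs_costNoise_le {ω : Path} (hω : Realizable vbar ω) (t : ℕ) :
    |costNoise G vbar ρ ε T ω t| ≤ vbar := by
  have hb0 := algBid_nonneg ρ ε ω t
  have hbv := (algBid_le_value ρ ε (hω t).1).trans (hω t).2.1
  have h1 : |wins ρ ε ω t - winProb G (algBid ρ ε ω t)| ≤ 1 := by
    have a1 := wins_nonneg ρ ε (ω := ω) t
    have a2 := wins_le_one ρ ε (ω := ω) t
    have a3 := winProb_nonneg G (algBid ρ ε ω t)
    have a4 := winProb_le_one G (algBid ρ ε ω t)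
    rw [abs_le]; constructor <;> linarith
  have h2 : runs vbar ρ ε T ω t * algBid ρ ε ω t ≤ vbar := by
    nlinarith [runs_nonneg vbar ρ ε T (ω := ω) t, runs_le_one vbar ρ ε T (ω := ω) t]
  rw [costNoise, abs_mul, abs_of_nonneg (mul_nonneg (runs_nonneg vbar ρ ε T t) hb0)]
  nlinarith [abs_nonneg (wins ρ ε ω t - winProb G (algBid ρ ε ω t))]

theorem abs_sum_costNoise_le {ω : Path} (hω : Realizable vbar ω) (n : ℕ) :
    |∑ t ∈ Finset.Icc 2 n, costNoise G vbar ρ ε T ω t| ≤ n * vbar := by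
  have hv : 0 ≤ vbar := (hω 0).1.trans (hω 0).2.1
  refine (Finset.abs_sum_le_sum_abs _ _).trans ?_
  refine (Finset.sum_le_sum fun t _ => abs_costNoise_le hω t).trans ?_
  rw [Finset.sum_const, Nat.card_Icc, nsmul_eq_mul]
  exact mul_le_mul_of_nonneg_right (by exact_mod_cast (by omega)) hv

/-- The second moment of the accumulated cost noise grows linearly. -/
theorem integral_sq_sum_costNoise_le (hF : F (Set.Icc 0 vbar) = 1) (hG : G (Set.Ici 0) = 1)
    (n : ℕ) :
    ∫ ω, (∑ t ∈ Finset.Icc 2 n, costNoise G vbar ρ ε T ω t) ^ 2 ∂(pathLaw F G) ≤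
      n * vbar ^ 2 := by
  induction n with
  | zero => simp
  | succ n ih =>
    rcases Nat.lt_or_ge n 1 with h | h
    · have : n = 0 := by omega
      subst this
      simpa using sq_nonneg vbar
    set S : Path → ℝ := fun ω => ∑ t ∈ Finset.Icc 2 n, costNoise G vbar ρ ε T ω t with hS
    set X : Path → ℝ := fun ω => costNoise G vbar ρ ε T ω (n + 1) with hX
    have hSm : Measurable S := Finset.measurable_sum _ fun t _ => measurable_costNoise t
    have hXm : Measurable X := measurable_costNoise (n + 1)
    have hv0 : ∀ ω, Realizable vbar ω → 0 ≤ vbar := fun ω hω => (hω 0).1.trans (hω 0).2.1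
    have i1 : Integrable (fun ω => S ω ^ 2) (pathLaw F G) := by
      refine integrable_of_realizable G F hF hG (hSm.pow_const 2) ((n * vbar) ^ 2) fun ω hω => ?_
      rw [abs_pow]
      exact pow_le_pow_left₀ (abs_nonneg _) (abs_sum_costNoise_le hω n) 2
    have i2 : Integrable (fun ω => 2 * (S ω * X ω)) (pathLaw F G) := by
      refine integrable_of_realizable G F hF hG ((hSm.mul hXm).const_mul 2)
        (2 * ((n * vbar) * vbar)) fun ω hω => ?_
      rw [abs_mul, abs_mul, abs_two]
      refine mul_le_mul_of_nonneg_left ?_ (by norm_num)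
      exact mul_le_mul (abs_sum_costNoise_le hω n) (abs_costNoise_le hω _) (abs_nonneg _)
        (mul_nonneg (Nat.cast_nonneg _) (hv0 ω hω))
    have hX2 : ∀ ω, Realizable vbar ω → X ω ^ 2 ≤ vbar ^ 2 := fun ω hω =>
      sq_le_sq' (by linarith [(abs_le.1 (abs_costNoise_le (G := G) (ρ := ρ) (ε := ε) (T := T)
        hω (n + 1))).1]) (abs_le.1 (abs_costNoise_le hω _)).2
    have i3 : Integrable (fun ω => X ω ^ 2) (pathLaw F G) := by
      refine integrable_of_realizable G F hF hG (hXm.pow_const 2) (vbar ^ 2) fun ω hω => ?_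
      rw [abs_of_nonneg (sq_nonneg _)]
      exact hX2 ω hω
    -- Martingale orthogonality: the past noise, entry and bid do not depend on the competing bid of
    -- round `n + 1`.
    have horth : ∫ ω, S ω * X ω ∂(pathLaw F G) = 0 := by
      have := integral_mul_win_sub_winProb F G
        (fun ω => S ω * (runs vbar ρ ε T ω (n + 1) * algBid ρ ε ω (n + 1)))
        (fun ω => algBid ρ ε ω (n + 1)) (n + 1)
        (fun ω v d d' => by
          rw [algBid_update ω (n + 1) v d d', runs_update ω (n + 1) (v, d) (v, d')]
          congr 1
          refine Finset.sum_congr rfl fun t ht => ?_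
          have htn := (Finset.mem_Icc.1 ht).2
          exact costNoise_congr (fun s _ hs => update_eq_update _ _ s (by omega))
            (update_eq_update _ _ t (by omega)))
        (fun ω v d d' => algBid_update ω (n + 1) v d d')
      rw [← this]
      refine integral_congr_ae (.of_forall fun ω => ?_)
      simp only [hX, costNoise, wins]
      ring
    have hexp : ∀ ω, (∑ t ∈ Finset.Icc 2 (n + 1), costNoise G vbar ρ ε T ω t) ^ 2 =
        (S ω ^ 2 + 2 * (S ω * X ω)) + X ω ^ 2 := by
      intro ω
      rw [Finset.sum_Icc_succ_top (by omega)]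
      simp only [hS, hX]
      ring
    simp only [hexp]
    have i12 : Integrable (fun ω => S ω ^ 2 + 2 * (S ω * X ω)) (pathLaw F G) := i1.add i2
    rw [integral_add i12 i3, integral_add i1 i2, integral_const_mul, horth]
    have h3 : ∫ ω, X ω ^ 2 ∂(pathLaw F G) ≤ vbar ^ 2 := by
      calc _ ≤ ∫ _, vbar ^ 2 ∂(pathLaw F G) := by
            refine integral_mono_ae i3 (integrable_const _) ?_
            filter_upwards [ae_realizable F G hF hG] with ω hω using hX2 ω hω
        _ = vbar ^ 2 := by simp
    push_cast
    linarith

theorem integrable_abs_sum_costNoise (hF : F (Set.Icc 0 vbar) = 1) (hG : G (Set.Ici 0) = 1)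
    (n : ℕ) : Integrable (fun ω => |∑ t ∈ Finset.Icc 2 n, costNoise G vbar ρ ε T ω t|)
      (pathLaw F G) := by
  refine integrable_of_realizable G F hF hG
    (Finset.measurable_sum _ fun t _ => measurable_costNoise t).abs (n * vbar) fun ω hω => ?_
  rw [abs_abs]
  exact abs_sum_costNoise_le hω n

theorem integral_abs_sum_costNoise_le (hv : 0 < vbar) (hF : F (Set.Icc 0 vbar) = 1)
    (hG : G (Set.Ici 0) = 1) (hT : 0 < T) :
    ∫ ω, |∑ t ∈ Finset.Icc 2 T, costNoise G vbar ρ ε T ω t| ∂(pathLaw F G) ≤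
      vbar * Real.sqrt T := by
  have hT' : (0 : ℝ) < T := by exact_mod_cast hT
  set a := vbar * Real.sqrt T with ha
  have ha0 : 0 < a := mul_pos hv (Real.sqrt_pos.2 hT')
  have ha2 : a ^ 2 = T * vbar ^ 2 := by
    rw [ha, mul_pow, Real.sq_sqrt hT'.le]; ring
  have hm : Measurable fun ω => ∑ t ∈ Finset.Icc 2 T, costNoise G vbar ρ ε T ω t :=
    Finset.measurable_sum _ fun t _ => measurable_costNoise t
  have i1 : Integrable (fun ω => (∑ t ∈ Finset.Icc 2 T, costNoise G vbar ρ ε T ω t) ^ 2)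
      (pathLaw F G) := by
    refine integrable_of_realizable G F hF hG (hm.pow_const 2) ((T * vbar) ^ 2) fun ω hω => ?_
    rw [abs_pow]
    exact pow_le_pow_left₀ (abs_nonneg _) (abs_sum_costNoise_le hω T) 2
  -- Instead of Cauchy–Schwarz: `y ≤ y ^ 2 / (2 a) + a / 2`, with `a` the bound on the root mean
  -- square.
  have h1 : ∫ ω, |∑ t ∈ Finset.Icc 2 T, costNoise G vbar ρ ε T ω t| ∂(pathLaw F G) ≤
      ∫ ω, (1 / (2 * a) * (∑ t ∈ Finset.Icc 2 T, costNoise G vbar ρ ε T ω t) ^ 2 + a / 2)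
        ∂(pathLaw F G) := by
    refine integral_mono (integrable_abs_sum_costNoise hF hG T)
      ((i1.const_mul _).add (integrable_const _)) fun ω => ?_
    dsimp only
    rw [← sq_abs (∑ t ∈ Finset.Icc 2 T, costNoise G vbar ρ ε T ω t)]
    set y := |∑ t ∈ Finset.Icc 2 T, costNoise G vbar ρ ε T ω t|
    have : 1 / (2 * a) * y ^ 2 + a / 2 - y = (y - a) ^ 2 / (2 * a) := by
      field_simp; ring
    have h2 : 0 ≤ (y - a) ^ 2 / (2 * a) := by positivity
    linarith
  rw [integral_add (i1.const_mul _) (integrable_const _), integral_const_mul] at h1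
  have h2 := mul_le_mul_of_nonneg_left
    (integral_sq_sum_costNoise_le (ρ := ρ) (ε := ε) (T := T) hF hG T)
    (by positivity : 0 ≤ 1 / (2 * a))
  rw [← ha2] at h2
  have h3 : 1 / (2 * a) * a ^ 2 = a / 2 := by field_simp
  simp only [integral_const, probReal_univ, one_smul] at h1
  linarith

theorem integrable_runs_mul_bestAdjReward (hv : 0 ≤ vbar) (hF : F (Set.Icc 0 vbar) = 1)
    (hG : G (Set.Ici 0) = 1) (t : ℕ) :
    Integrable (fun ω => runs vbar ρ ε T ω t *
      bestAdjReward G vbar (algLam ρ ε ω t, (ω t).1)) (pathLaw F G) := by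
  refine integrable_of_realizable G F hF hG ((measurable_runs t).mul
    ((measurable_bestAdjReward G hv).comp
      ((measurable_algLam ρ ε t).prodMk (measurable_value t)))) vbar fun ω hω => ?_
  have h1 := bestAdjReward_nonneg G hv (p := (algLam ρ ε ω t, (ω t).1)) (hω t).1
  have h2 := bestAdjReward_le_value G hv (p := (algLam ρ ε ω t, (ω t).1)) (hω t).1
    (algLam_nonneg ρ ε ω t)
  rw [abs_of_nonneg (mul_nonneg (runs_nonneg vbar ρ ε T t) h1)]
  dsimp only at h2
  nlinarith [runs_nonneg vbar ρ ε T (ω := ω) t, runs_le_one vbar ρ ε T (ω := ω) t, (hω t).2.1]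

theorem integrable_runs_mul_algLam_mul (hρ : 0 ≤ ρ) (hε : 0 ≤ ε) (hF : F (Set.Icc 0 vbar) = 1)
    (hG : G (Set.Ici 0) = 1) (t : ℕ) {f : Path → ℝ} (hf : Measurable f) (C : ℝ)
    (hC : ∀ ω, Realizable vbar ω → |f ω| ≤ C) :
    Integrable (fun ω => runs vbar ρ ε T ω t * (algLam ρ ε ω t * f ω)) (pathLaw F G) := by
  refine integrable_of_realizable G F hF hG ((measurable_runs t).mul
    ((measurable_algLam ρ ε t).mul hf)) (ε * vbar * t * C) fun ω hω => ?_
  have h1 := algLam_nonneg ρ ε ω t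
  have h2 := algLam_le hω hρ hε t
  have h3 : |algLam ρ ε ω t * f ω| ≤ ε * vbar * t * C := by
    rw [abs_mul, abs_of_nonneg h1]
    exact mul_le_mul h2 (hC ω hω) (abs_nonneg _) (h1.trans h2)
  rw [abs_mul, abs_of_nonneg (runs_nonneg vbar ρ ε T t)]
  nlinarith [runs_nonneg vbar ρ ε T (ω := ω) t, runs_le_one vbar ρ ε T (ω := ω) t,
    abs_nonneg (algLam ρ ε ω t * f ω)]

theorem integrable_runs (t : ℕ) :
    Integrable (fun ω => runs vbar ρ ε T ω t) (pathLaw F G) :=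
  .of_bound (measurable_runs t).aestronglyMeasurable 1 (.of_forall fun ω => by
    rw [Real.norm_eq_abs, abs_of_nonneg (runs_nonneg vbar ρ ε T t)]
    exact runs_le_one vbar ρ ε T t)

/-- The current value is independent of the multiplier, so that the best adjusted reward dominates
every lower bound of the dual function in mean. -/
theorem integral_runs_mul_bestAdjReward_ge (hv : 0 ≤ vbar) (hρ : 0 ≤ ρ) (hε : 0 ≤ ε)
    (hF : F (Set.Icc 0 vbar) = 1) (hG : G (Set.Ici 0) = 1) {V : ℝ}
    (hV : ∀ lam, 0 ≤ lam → V ≤ dualValue G F vbar ρ lam) (t : ℕ) :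
    ∫ ω, runs vbar ρ ε T ω t * (V - algLam ρ ε ω t * ρ) ∂(pathLaw F G) ≤
      ∫ ω, runs vbar ρ ε T ω t * bestAdjReward G vbar (algLam ρ ε ω t, (ω t).1)
        ∂(pathLaw F G) := by
  have hi := integrable_runs_mul_bestAdjReward (ρ := ρ) (ε := ε) (T := T) hv hF hG t
  have hres := (integrable_resample F G hi t).integral_prod_left
  rw [integral_resample F G hi t]
  refine integral_mono ?_ hres fun ω => ?_
  · have h1 := (integrable_runs (F := F) (G := G) (vbar := vbar) (ρ := ρ) (ε := ε) (T := T)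
      t).mul_const V
    have h2 := integrable_runs_mul_algLam_mul (T := T) hρ hε hF hG t
      (measurable_const (a := ρ)) ρ (fun ω _ => (abs_of_nonneg hρ).le)
    refine (h1.sub h2).congr (.of_forall fun ω => ?_)
    simp only [Pi.sub_apply]
    ring
  -- Resampling round `t` leaves `runs` and the multiplier of that round unchanged, so the inner
  -- integral is the one in `dualValue` at a fixed multiplier.
  · have hr : ∀ x, runs vbar ρ ε T (Function.update ω t x) t = runs vbar ρ ε T ω t := fun x =>
      runs_congr fun s _ hs => by simp [Function.update_of_ne hs.ne]
    have hl : ∀ x, algLam ρ ε (Function.update ω t x) t = algLam ρ ε ω t := fun x =>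
      algLam_congr ρ ε fun s _ hs => by simp [Function.update_of_ne hs.ne]
    simp only [hr, hl, Function.update_self]
    rw [integral_const_mul]
    refine mul_le_mul_of_nonneg_left ?_ (runs_nonneg vbar ρ ε T t)
    have hφm : Measurable fun v => bestAdjReward G vbar (algLam ρ ε ω t, v) :=
      (measurable_bestAdjReward G hv).comp measurable_prodMk_left
    have hfst : ∫ x, bestAdjReward G vbar (algLam ρ ε ω t, x.1) ∂(F.prod G) =
        ∫ v, bestAdjReward G vbar (algLam ρ ε ω t, v) ∂F := by
      rw [integral_fun_fst (f := fun v => bestAdjReward G vbar (algLam ρ ε ω t, v))]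
      simp
    rw [hfst]
    have := hV _ (algLam_nonneg ρ ε ω t)
    unfold dualValue at this
    linarith

theorem abs_value_sub_algBid_le {ω : Path} (hω : Realizable vbar ω) (t : ℕ) :
    |(ω t).1 - algBid ρ ε ω t| ≤ vbar := by
  have hb0 := algBid_nonneg ρ ε ω t
  have hbv := algBid_le_value ρ ε (hω t).1
  rw [abs_of_nonneg (by linarith)]
  linarith [(hω t).2.1]

theorem integrable_runs_mul_value_sub_mul (hF : F (Set.Icc 0 vbar) = 1)
    (hG : G (Set.Ici 0) = 1) (t : ℕ) {f : Path → ℝ} (hf : Measurable f)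
    (h0 : ∀ ω, 0 ≤ f ω) (h1 : ∀ ω, f ω ≤ 1) :
    Integrable (fun ω => runs vbar ρ ε T ω t * (((ω t).1 - algBid ρ ε ω t) * f ω))
      (pathLaw F G) := by
  refine integrable_of_realizable G F hF hG ((measurable_runs t).mul
    (((measurable_value t).sub (measurable_algBid ρ ε t)).mul hf)) vbar fun ω hω => ?_
  have h2 := abs_value_sub_algBid_le (ρ := ρ) (ε := ε) hω t
  rw [abs_mul, abs_mul, abs_of_nonneg (runs_nonneg vbar ρ ε T t), abs_of_nonneg (h0 ω)]
  have h3 : |(ω t).1 - algBid ρ ε ω t| * f ω ≤ vbar := by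
    nlinarith [h0 ω, h1 ω, abs_nonneg ((ω t).1 - algBid ρ ε ω t)]
  have h4 : 0 ≤ |(ω t).1 - algBid ρ ε ω t| * f ω := mul_nonneg (abs_nonneg _) (h0 ω)
  nlinarith [runs_nonneg vbar ρ ε T (ω := ω) t, runs_le_one vbar ρ ε T (ω := ω) t]

theorem performance_algorithm (hF : F (Set.Icc 0 vbar) = 1) (hG : G (Set.Ici 0) = 1) :
    performance F G T (algorithm vbar ρ ε T) =
      ∑ t ∈ Finset.Icc 1 T, ∫ ω, runs vbar ρ ε T ω t *
        (((ω t).1 - algBid ρ ε ω t) * wins ρ ε ω t) ∂(pathLaw F G) := by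
  have hm : Measurable fun ω : Path => ∑ t ∈ Finset.Icc 1 T, runs vbar ρ ε T ω t *
      (((ω t).1 - algBid ρ ε ω t) * wins ρ ε ω t) :=
    Finset.measurable_sum _ fun t _ => (measurable_runs t).mul
      (((measurable_value t).sub (measurable_algBid ρ ε t)).mul (measurable_wins t))
  rw [← integral_finsetSum _ fun t _ => integrable_runs_mul_value_sub_mul hF hG t
    (measurable_wins t) (fun ω => wins_nonneg ρ ε t) (fun ω => wins_le_one ρ ε t)]
  have h : performance F G T (algorithm vbar ρ ε T) =
      ∫ z : Path × Unit, ∑ t ∈ Finset.Icc 1 T, runs vbar ρ ε T z.1 t *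
        (((z.1 t).1 - algBid ρ ε z.1 t) * wins ρ ε z.1 t)
        ∂((pathLaw F G).prod (Measure.dirac ())) := by
    unfold performance
    refine integral_congr_ae (.of_forall fun z => ?_)
    exact Finset.sum_congr rfl fun t _ => algorithm_reward vbar ρ ε T t z.2
  rw [h, Measure.prod_dirac]
  exact integral_map (f := fun z : Path × Unit => ∑ t ∈ Finset.Icc 1 T, runs vbar ρ ε T z.1 t *
    (((z.1 t).1 - algBid ρ ε z.1 t) * wins ρ ε z.1 t)) (by fun_prop)
    (hm.comp measurable_fst).aestronglyMeasurable

/-- The expected reward of a round is at least the expected Lagrangian gain, up to the estimation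
error. -/
theorem integral_lagrangian_le_reward (hv : 0 ≤ vbar) (hρ : 0 ≤ ρ) (hε : 0 ≤ ε)
    (hF : F (Set.Icc 0 vbar) = 1) (hG : G (Set.Ici 0) = 1) {V : ℝ}
    (hV : ∀ lam, 0 ≤ lam → V ≤ dualValue G F vbar ρ lam) (hT : 0 < T) {t : ℕ} (ht : 2 ≤ t) :
    Integrable (fun ω => runs vbar ρ ε T ω t *
        (V - algLam ρ ε ω t * (ρ - empCost ω t (algBid ρ ε ω t)))) (pathLaw F G) ∧
    ∫ ω, runs vbar ρ ε T ω t *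
        (V - algLam ρ ε ω t * (ρ - empCost ω t (algBid ρ ε ω t))) ∂(pathLaw F G) -
        2 * vbar * ∫ ω, estError G T t ω ∂(pathLaw F G) ≤
      ∫ ω, runs vbar ρ ε T ω t * (((ω t).1 - algBid ρ ε ω t) * wins ρ ε ω t)
        ∂(pathLaw F G) := by
  have iφ := integrable_runs_mul_bestAdjReward (ρ := ρ) (ε := ε) (T := T) hv hF hG t
  have ic := integrable_runs_mul_algLam_mul (T := T) hρ hε hF hG t
    (measurable_empCost_algBid (ρ := ρ) (ε := ε) t) vbar fun ω hω => by
      rw [abs_of_nonneg (empCost_algBid_nonneg ht)]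
      exact empCost_algBid_le hω ht
  have iV : Integrable (fun ω => runs vbar ρ ε T ω t * (V - algLam ρ ε ω t * ρ))
      (pathLaw F G) := by
    have h1 := (integrable_runs (F := F) (G := G) (vbar := vbar) (ρ := ρ) (ε := ε) (T := T)
      t).mul_const V
    have h2 := integrable_runs_mul_algLam_mul (T := T) hρ hε hF hG t
      (measurable_const (a := ρ)) ρ (fun ω _ => (abs_of_nonneg hρ).le)
    refine (h1.sub h2).congr (.of_forall fun ω => ?_)
    simp only [Pi.sub_apply]
    ring
  have iw := integrable_runs_mul_value_sub_mul (ρ := ρ) (ε := ε) (T := T) hF hG t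
    (measurable_wins t) (fun ω => wins_nonneg ρ ε t) (fun ω => wins_le_one ρ ε t)
  have ig := integrable_runs_mul_value_sub_mul (ρ := ρ) (ε := ε) (T := T) hF hG t
    (measurable_winProb_algBid (G := G) (ρ := ρ) (ε := ε) t) (fun ω => winProb_nonneg G _)
    (fun ω => winProb_le_one G _)
  have iΔ := integrable_estError F G T t
  have hsplit : ∀ ω, runs vbar ρ ε T ω t *
      (V - algLam ρ ε ω t * (ρ - empCost ω t (algBid ρ ε ω t))) =
      runs vbar ρ ε T ω t * (V - algLam ρ ε ω t * ρ) +
        runs vbar ρ ε T ω t * (algLam ρ ε ω t * empCost ω t (algBid ρ ε ω t)) :=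
    fun ω => by ring
  have hwin : ∫ ω, runs vbar ρ ε T ω t * (((ω t).1 - algBid ρ ε ω t) * wins ρ ε ω t)
        ∂(pathLaw F G) =
      ∫ ω, runs vbar ρ ε T ω t *
        (((ω t).1 - algBid ρ ε ω t) * winProb G (algBid ρ ε ω t)) ∂(pathLaw F G) := by
    have hz := integral_mul_win_sub_winProb F G
      (fun ω => runs vbar ρ ε T ω t * ((ω t).1 - algBid ρ ε ω t)) (fun ω => algBid ρ ε ω t) t
      (fun ω v d d' => by
        rw [algBid_update ω t v d d', runs_update ω t (v, d) (v, d')]; simp)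
      (fun ω v d d' => algBid_update ω t v d d')
    refine sub_eq_zero.1 ((integral_sub iw ig).symm.trans (Eq.trans ?_ hz))
    refine integral_congr_ae (.of_forall fun ω => ?_)
    simp only [wins]
    ring
  refine ⟨(iV.add ic).congr (.of_forall fun ω => (hsplit ω).symm), ?_⟩
  simp only [hsplit]
  rw [hwin, integral_add iV ic, ← integral_const_mul]
  have h1 := integral_runs_mul_bestAdjReward_ge (T := T) hv hρ hε hF hG hV t
  have h2 : ∫ ω, (runs vbar ρ ε T ω t * bestAdjReward G vbar (algLam ρ ε ω t, (ω t).1) +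
        runs vbar ρ ε T ω t * (algLam ρ ε ω t * empCost ω t (algBid ρ ε ω t)) -
        2 * vbar * estError G T t ω) ∂(pathLaw F G) ≤
      ∫ ω, runs vbar ρ ε T ω t *
        (((ω t).1 - algBid ρ ε ω t) * winProb G (algBid ρ ε ω t)) ∂(pathLaw F G) := by
    refine integral_mono_ae ((iφ.add ic).sub (iΔ.const_mul _)) ig ?_
    filter_upwards [ae_realizable F G hF hG] with ω hω
    have a1 := mul_le_mul_of_nonneg_left
      (bestAdjReward_add_le G (ρ := ρ) (ε := ε) hω hT ht) (runs_nonneg vbar ρ ε T (ω := ω) t)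
    have a2 := mul_le_mul_of_nonneg_right (runs_le_one vbar ρ ε T (ω := ω) t)
      (mul_nonneg (mul_nonneg zero_le_two hv) (estError_nonneg G T t ω))
    linarith
  have iφc : Integrable (fun ω => runs vbar ρ ε T ω t *
      bestAdjReward G vbar (algLam ρ ε ω t, (ω t).1) +
        runs vbar ρ ε T ω t * (algLam ρ ε ω t * empCost ω t (algBid ρ ε ω t)))
      (pathLaw F G) := iφ.add ic
  rw [integral_sub iφc (iΔ.const_mul _), integral_add iφ ic] at h2
  linarith

/-- Combines the bound per round with the pathwise bound. The estimation error enters twice: `2 *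
vbar` from choosing the bid, `vbar / ρ * vbar` from measuring the spending. -/
theorem performance_algorithm_ge (hρ : 0 < ρ) (hρv : ρ ≤ vbar) (hε : 0 < ε)
    (hF : F (Set.Icc 0 vbar) = 1) (hG : G (Set.Ici 0) = 1) (hT : 2 ≤ T) {V : ℝ}
    (hV : ∀ lam, 0 ≤ lam → V ≤ dualValue G F vbar ρ lam) :
    T * V - (vbar + vbar / ρ * vbar + (vbar / ρ) ^ 2 / (2 * ε) + ε * T * vbar ^ 2 / 2 +
        (2 * vbar + vbar / ρ * vbar) * (2 * Real.sqrt (T * Real.log T) + 7) +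
        vbar / ρ * (vbar * Real.sqrt T)) ≤
      performance F G T (algorithm vbar ρ ε T) := by
  have hv : 0 < vbar := hρ.trans_le hρv
  have hl : 0 < vbar / ρ := div_pos hv hρ
  have hT0 : 0 < T := by omega
  have hround := fun t (ht : t ∈ Finset.Icc 2 T) => integral_lagrangian_le_reward (T := T)
    hv.le hρ.le hε.le hF hG hV hT0 (Finset.mem_Icc.1 ht).1
  have hVv : V ≤ vbar := (hV 0 le_rfl).trans (dualValue_zero_le G F hv.le ρ hF)
  have hΔ := sum_integral_estError_le F G hT
  have hM := integral_abs_sum_costNoise_le (ρ := ρ) (ε := ε) (T := T) hv hF hG hT0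
  have h1 : 0 ≤ ∫ ω, runs vbar ρ ε T ω 1 * (((ω 1).1 - algBid ρ ε ω 1) * wins ρ ε ω 1)
      ∂(pathLaw F G) := by
    refine integral_nonneg_of_ae ?_
    filter_upwards [ae_realizable F G hF hG] with ω hω
    exact mul_nonneg (runs_nonneg vbar ρ ε T 1)
      (mul_nonneg (sub_nonneg.2 (algBid_le_value ρ ε (hω 1).1)) (wins_nonneg ρ ε 1))
  rw [performance_algorithm hF hG, sum_Icc_one_eq (by omega)]
  have h2 := Finset.sum_le_sum fun t ht => (hround t ht).2
  rw [Finset.sum_sub_distrib, ← Finset.mul_sum,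
    ← integral_finsetSum _ fun t ht => (hround t ht).1] at h2
  set K := vbar + vbar / ρ * vbar + (vbar / ρ) ^ 2 / (2 * ε) + ε * T * vbar ^ 2 / 2 with hK
  have iΔ : Integrable (fun ω => ∑ t ∈ Finset.Icc 2 T, estError G T t ω) (pathLaw F G) :=
    integrable_finsetSum _ fun t _ => integrable_estError F G T t
  have iM := integrable_abs_sum_costNoise (ρ := ρ) (ε := ε) (T := T) hF hG T
  have iE : Integrable (fun ω => vbar / ρ * vbar * ∑ t ∈ Finset.Icc 2 T, estError G T t ω +
      vbar / ρ * |∑ t ∈ Finset.Icc 2 T, costNoise G vbar ρ ε T ω t|) (pathLaw F G) :=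
    (iΔ.const_mul _).add (iM.const_mul _)
  have h3 : ∫ ω, ((T * V - K) - (vbar / ρ * vbar * ∑ t ∈ Finset.Icc 2 T, estError G T t ω +
        vbar / ρ * |∑ t ∈ Finset.Icc 2 T, costNoise G vbar ρ ε T ω t|)) ∂(pathLaw F G) ≤
      ∫ ω, ∑ t ∈ Finset.Icc 2 T, runs vbar ρ ε T ω t *
        (V - algLam ρ ε ω t * (ρ - empCost ω t (algBid ρ ε ω t))) ∂(pathLaw F G) := by
    refine integral_mono_ae ((integrable_const _).sub iE)
      (integrable_finsetSum _ fun t ht => (hround t ht).1) ?_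
    filter_upwards [ae_realizable F G hF hG] with ω hω
    have := le_sum_runs_mul_lagrangian G hω hρ hρv hε hT hVv
    linarith
  rw [integral_sub (integrable_const _) iE,
    integral_add (iΔ.const_mul _) (iM.const_mul _), integral_const_mul, integral_const_mul,
    integral_finsetSum _ fun t _ => integrable_estError F G T t] at h3
  simp only [integral_const, probReal_univ, one_smul] at h3
  have h4 := mul_le_mul_of_nonneg_left hΔ
    (by positivity : 0 ≤ 2 * vbar + vbar / ρ * vbar)
  have h5 := mul_le_mul_of_nonneg_left hM hl.le
  linarith

end Expectation
end FirstPrice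

/-! ### The regret bound -/

theorem theorem1 (vbar ρ c₁ c₂ : ℝ) (hρ : 0 < ρ) (hρv : ρ ≤ vbar) (hc₁ : 0 < c₁) :
    ∃ C : ℝ, ∀ (T : ℕ), 2 ≤ T →
      ∀ ε : ℝ, c₁ / Real.sqrt T ≤ ε → ε ≤ c₂ / Real.sqrt T →
      (FirstPrice.algorithm vbar ρ ε T).Valid ∧
      (vbar ≤ ρ * T → (FirstPrice.algorithm vbar ρ ε T).BudgetFeasible vbar ρ T) ∧
      ∀ (F G : Measure ℝ) [IsProbabilityMeasure F] [IsProbabilityMeasure G],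
        F (Set.Icc 0 vbar) = 1 → G (Set.Ici 0) = 1 →
        BddAbove (FirstPrice.performance F G T '' FirstPrice.feasibleStrategies vbar ρ T) ∧
        FirstPrice.regret vbar ρ F G T (FirstPrice.algorithm vbar ρ ε T) ≤
          C * Real.sqrt (T * Real.log T) := by
  have hv : 0 < vbar := hρ.trans_le hρv
  refine ⟨2 * (vbar + vbar / ρ * vbar) + (vbar / ρ) ^ 2 / c₁ + c₂ * vbar ^ 2 +
    16 * (2 * vbar + vbar / ρ * vbar) + 2 * (vbar / ρ * vbar), fun T hT ε hε₁ hε₂ => ?_⟩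
  have hT2 : (2 : ℝ) ≤ T := by exact_mod_cast hT
  have hs : 0 < Real.sqrt T := Real.sqrt_pos.2 (by linarith)
  have hε : 0 < ε := (div_pos hc₁ hs).trans_le hε₁
  refine ⟨FirstPrice.algorithm_valid vbar ρ ε T,
    fun h => FirstPrice.algorithm_budgetFeasible ρ ε T h hv.le, fun F G _ _ hF hG => ?_⟩
  have hdual := fun (lam : ℝ) (hlam : 0 ≤ lam) (π : FirstPrice.Strategy)
    (hπ : π ∈ FirstPrice.feasibleStrategies vbar ρ T) =>
    FirstPrice.performance_le_dualValue G hv.le hF hG hρ.le hlam hπ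
  refine ⟨⟨_, by rintro _ ⟨π, hπ, rfl⟩; exact hdual 0 le_rfl π hπ⟩, ?_⟩
  set R := sSup (FirstPrice.performance F G T '' FirstPrice.feasibleStrategies vbar ρ T) with hR
  -- Weak duality makes the benchmark per round an admissible `V`, and `T * V` is then the benchmark
  -- itself.
  have hV : ∀ lam, 0 ≤ lam → R / T ≤ FirstPrice.dualValue G F vbar ρ lam := by
    intro lam hlam
    rw [div_le_iff₀ (by linarith), mul_comm]
    refine Real.sSup_le ?_ (mul_nonneg (by linarith)
      (FirstPrice.dualValue_nonneg G F hv.le hρ.le hlam hF))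
    rintro _ ⟨π, hπ, rfl⟩
    exact hdual lam hlam π hπ
  have hperf := FirstPrice.performance_algorithm_ge hρ hρv hε hF hG hT hV
  rw [mul_div_cancel₀ _ (by linarith : (T : ℝ) ≠ 0)] at hperf
  unfold FirstPrice.regret
  rw [← hR]
  set Q := Real.sqrt (T * Real.log T) with hQ
  have hs1 : 1 ≤ Real.sqrt T := by
    rw [Real.one_le_sqrt]; linarith
  -- Holds since `log T ≥ log 2 ≥ 1 / 4`. With `1 ≤ sqrt T` it also gives `1 ≤ 2 * Q`, which absorbs
  -- the constant terms, e.g. `2 * Q + 7 ≤ 16 * Q`.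
  have hsQ : Real.sqrt T ≤ 2 * Q := by
    have hlog : 1 / 4 ≤ Real.log T := by
      have := Real.log_le_log (by norm_num) hT2
      linarith [Real.log_two_gt_d9]
    have h4 : 2 * Q = Real.sqrt (4 * (T * Real.log T)) := by
      rw [Real.sqrt_mul (by norm_num), hQ]
      congr 1
      rw [show (4 : ℝ) = 2 ^ 2 by norm_num, Real.sqrt_sq (by norm_num)]
    rw [h4]
    exact Real.sqrt_le_sqrt (by nlinarith)
  have hss : Real.sqrt T * Real.sqrt T = T := Real.mul_self_sqrt (by linarith)
  have e1 : (vbar / ρ) ^ 2 / (2 * ε) ≤ (vbar / ρ) ^ 2 / c₁ * Q := by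
    have h1 : c₁ ≤ ε * Real.sqrt T := (div_le_iff₀ hs).1 hε₁
    have h2 : 1 / (2 * ε) ≤ Q / c₁ := by
      rw [div_le_div_iff₀ (by positivity) hc₁]
      nlinarith
    have h3 := mul_le_mul_of_nonneg_left h2 (sq_nonneg (vbar / ρ))
    calc _ = (vbar / ρ) ^ 2 * (1 / (2 * ε)) := by ring
      _ ≤ _ := h3
      _ = _ := by ring
  have e2 : ε * T * vbar ^ 2 / 2 ≤ c₂ * vbar ^ 2 * Q := by
    have h1 : ε * Real.sqrt T ≤ c₂ := (le_div_iff₀ hs).1 hε₂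
    have h2 : ε * T ≤ c₂ * (2 * Q) := by
      have hc₂ : 0 ≤ c₂ := (mul_pos hε hs).le.trans h1
      calc ε * T = ε * Real.sqrt T * Real.sqrt T := by rw [mul_assoc, hss]
        _ ≤ c₂ * Real.sqrt T := mul_le_mul_of_nonneg_right h1 hs.le
        _ ≤ c₂ * (2 * Q) := mul_le_mul_of_nonneg_left hsQ hc₂
    have h3 := mul_le_mul_of_nonneg_right h2 (sq_nonneg vbar)
    linarith
  have hlv : 0 < vbar / ρ * vbar := mul_pos (div_pos hv hρ) hv
  have e3 : vbar / ρ * (vbar * Real.sqrt T) ≤ 2 * (vbar / ρ * vbar) * Q := by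
    have := mul_le_mul_of_nonneg_left hsQ hlv.le
    linarith
  have e4 : vbar + vbar / ρ * vbar ≤ 2 * (vbar + vbar / ρ * vbar) * Q := by
    nlinarith
  have e5 : (2 * vbar + vbar / ρ * vbar) * (2 * Q + 7) ≤
      16 * (2 * vbar + vbar / ρ * vbar) * Q := by
    nlinarith
  linarith
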